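/- Let $k$ be a perfect field of characteristic $p>2$. An affine $k$-supergroup scheme $G$ is a group-valued functor on the category of commutative superalgebras over $k$ (with even homomorphisms) of the form $A\mapsto G(A)=\mathrm{Hom}(k[G],A)$ for some commutative superalgebra $k[G]$; it is algebraic if $k[G]$ is finitely generated, finite if $\dim_k k[G]<\infty$, and infinitesimal if it is finite and the augmentation ideal of $k[G]$ is nilpotent. An étale group scheme is a purely even one whose coordinate algebra is étale (finite-dimensional and separable) over $k$. For a normal subgroup functor $N$ of $G$, a homomorphism $\pi\colon G\to Q$ of affine supergroup schemes identifies $Q$ with $G/N$ if $\pi$ is faithfully flat with kernel $N$. The first Frobenius kernel $G_1$ is the kernel of the Frobenius morphism $G(A)\to G(A^{(-1)})$ induced by $a\mapsto a^p$, where $A^{(-1)}$ is $A$ with $c\in k$ acting as $c^p$ acts on $A$. For an affine algebraic group scheme $H$, its component group is the maximal étale quotient group $H\to\pi_0(H)$: an étale quotient of $H$ through which every homomorphism from $H$ to an étale group scheme factors uniquely. Let $G$ be an affine algebraic $k$-supergroup scheme. Then the quotient $G/G_1$ exists and is an ordinary (purely even) affine algebraic group scheme; it has a component group, and we set $\pi_0(G):=\pi_0(G/G_1)$,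 an étale group scheme. Moreover, there is a closed normal subsupergroup scheme $G^0$ of $G$ such that the composite $G\to G/G_1\to\pi_0(G)$ identifies $G/G^0$ with $\pi_0(G)$. If $G$ is finite, then $G\cong G^0\rtimes\pi_0(G)$ as supergroup schemes, for some action of $\pi_0(G)$ on $G^0$ by group automorphisms and compatibly with the inclusion $G^0\to G$ and the projection $G\to\pi_0(G)$; and $G^0$ is infinitesimal. -/

import Mathlib

universe u

/-- A commutative superalgebra over `k`: a `ℤ/2`-graded `k`-algebra in which homogeneous elements
commute up to the usual sign. -/
structure CSAlg (k : Type u) [Field k] where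
  carrier : Type u
  [ring : Ring carrier]
  [algebra : Algebra k carrier]
  grading : ZMod 2 → Submodule k carrier
  [graded : GradedAlgebra grading]
  comm : ∀ {i j : ZMod 2} {a b : carrier}, a ∈ grading i → b ∈ grading j →
    a * b = (-1) ^ (i.val * j.val) * (b * a)

namespace CSAlg

variable {k : Type u} [Field k]

instance : CoeSort (CSAlg k) (Type u) := ⟨CSAlg.carrier⟩

instance (A : CSAlg k) : Ring A := A.ring

instance (A : CSAlg k) : Algebra k A := A.algebra

instance (A : CSAlg k) : GradedAlgebra A.grading := A.graded

/-- Morphisms of commutative superalgebras: even (degree-preserving) `k`-algebra homomorphisms. -/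
abbrev Hom (A B : CSAlg k) : Type u := A.grading →ₐᵍ[k] B.grading

/-- A superalgebra is purely even if it is concentrated in degree `0`. -/
def IsPurelyEven (A : CSAlg k) : Prop := A.grading 0 = ⊤

lemma commute_of_even (A : CSAlg k) {a : A} (ha : a ∈ A.grading 0) (b : A) : Commute a b := by
  induction b using DirectSum.Decomposition.inductionOn A.grading with
  | zero => exact Commute.zero_right a
  | homogeneous b =>
    have h := A.comm ha b.2
    simp only [ZMod.val_zero, zero_mul, pow_zero, one_mul] at h
    exact h
  | add b c hb hc => exact hb.add_right hc

/-- A purely even commutative superalgebra is a commutative ring in the ordinary sense. -/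
abbrev commRing (A : CSAlg k) (h : A.IsPurelyEven) : CommRing A :=
  { A.ring with
    mul_comm := fun a b => A.commute_of_even (h.symm ▸ Submodule.mem_top : a ∈ A.grading 0) b }

/-- An étale (separable) superalgebra: a purely even one whose underlying commutative algebra is
étale over the field `k`, i.e. a finite product of finite separable field extensions of `k`. -/
def IsEtale (A : CSAlg k) : Prop :=
  ∃ h : A.IsPurelyEven, letI := A.commRing h; Algebra.Etale k A

/-- The grading of an algebra concentrated in degree `0`. -/
def evenGrading (k : Type u) [Field k] (B : Type u) [CommRing B] [Algebra k B] (i : ZMod 2) :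
    Submodule k B :=
  if i = 0 then ⊤ else ⊥

instance (k : Type u) [Field k] (B : Type u) [CommRing B] [Algebra k B] :
    GradedAlgebra (evenGrading k B) :=
  { DirectSum.Decomposition.ofLinearMap (evenGrading k B)
      ((DirectSum.lof k (ZMod 2) (fun i => evenGrading k B i) 0).comp
        (LinearMap.codRestrict (evenGrading k B 0) LinearMap.id (fun _ => by simp [evenGrading])))
      (by ext b; simp)
      (by
        ext i x : 2
        by_cases hi : i = 0
        · subst hi
          simp only [LinearMap.comp_apply, DirectSum.coeLinearMap_lof, LinearMap.id_apply]
          rfl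
        · have hx : x = 0 := by
            apply Subtype.ext
            have := x.2
            simpa [evenGrading, hi] using this
          subst hx
          simp only [map_zero]) with
    one_mem := by simp [evenGrading]
    mul_mem := by
      intro i j a b ha hb
      by_cases hi : i = 0 <;> by_cases hj : j = 0 <;> simp_all [evenGrading] }

/-- An ordinary commutative algebra, regarded as a purely even superalgebra. -/
abbrev ofComm (k : Type u) [Field k] (B : Type u) [CommRing B] [Algebra k B] : CSAlg k where
  carrier := B
  grading := evenGrading k B
  comm := by
    intro i j a b ha hb
    by_cases hi : i = 0
    · simp [hi, mul_comm]
    · have : a = 0 := by simpa [evenGrading, hi] using ha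
      simp [this]

/-- A morphism `φ : A → B` is faithfully flat if `B` is a faithfully flat (right) `A`-module:
every linear relation with coefficients in `A` between elements of `B` is trivial (the equational
form of flatness, valid over noncommutative rings), and `B ⊗_A (A/I) = B/Bφ(I)` is nonzero for
every proper left ideal `I`. -/
structure IsFaithfullyFlat {A B : CSAlg k} (φ : Hom A B) : Prop where
  flat : ∀ (n : ℕ) (a : Fin n → A) (b : Fin n → B), ∑ i, b i * φ (a i) = 0 →
    ∃ (m : ℕ) (c : Fin m → Fin n → A) (d : Fin m → B),
      (∀ i, b i = ∑ j, d j * φ (c j i)) ∧ ∀ j, ∑ i, c j i * a i = 0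
  faithful : ∀ I : Ideal A, Ideal.map φ I = ⊤ → I = ⊤

lemma mul_self_of_odd {p : ℕ} [CharP k p] (hp : 2 < p) (A : CSAlg k) {a : A} (ha : a ∈ A.grading 1) :
    a * a = 0 := by
  have h := A.comm ha ha
  have h1 : (1 : ZMod 2).val = 1 := rfl
  rw [h1] at h
  have h2 : (2 : k) ≠ 0 := by
    intro h0
    have : p ∣ 2 := (CharP.cast_eq_zero_iff k p 2).1 (by exact_mod_cast h0)
    exact absurd (Nat.le_of_dvd (by norm_num) this) (by omega)
  have h3 : (2 : k) • (a * a) = 0 := by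
    rw [two_smul]
    nth_rewrite 1 [h]
    simp
  exact (smul_eq_zero.1 h3).resolve_left h2

section Frobenius

variable (p : ℕ) [Fact p.Prime] [CharP k p]

/-- The ring underlying `A⁽⁻¹⁾`, which is that of `A`. -/
def FrobTwist (A : CSAlg k) (_p : ℕ) : Type u := A.carrier

instance (A : CSAlg k) : Ring (A.FrobTwist p) := inferInstanceAs (Ring A)

/-- The twisted scalar multiplication: `c ∈ k` acts as `c ^ p` acts on `A`. -/
instance (A : CSAlg k) : Algebra k (A.FrobTwist p) := Algebra.compHom A (frobenius k p)

/-- `A⁽⁻¹⁾`: the superalgebra `A` with scalar multiplication twisted so that `c ∈ k` acts as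
`c ^ p` acts on `A`. -/
def frobTwist (A : CSAlg k) : CSAlg k where
  carrier := A.FrobTwist p
  grading i :=
    { carrier := {a : A | a ∈ A.grading i}
      add_mem' := fun ha hb => (A.grading i).add_mem ha hb
      zero_mem' := (A.grading i).zero_mem
      smul_mem' := fun c _ ha => (A.grading i).smul_mem (c ^ p) ha }
  graded :=
    { one_mem := A.graded.one_mem
      mul_mem := fun _ _ _ _ ha hb => A.graded.mul_mem ha hb
      decompose' := A.graded.decompose'
      left_inv := A.graded.left_inv
      right_inv := A.graded.right_inv }
  comm := A.comm

lemma exists_even_odd (A : CSAlg k) (a : A) :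
    ∃ x ∈ A.grading 0, ∃ y ∈ A.grading 1, a = x + y := by
  induction a using DirectSum.Decomposition.inductionOn A.grading with
  | zero => exact ⟨0, zero_mem _, 0, zero_mem _, by simp⟩
  | @homogeneous i b =>
    obtain ⟨b, hb⟩ := b
    fin_cases i
    · exact ⟨b, hb, 0, zero_mem _, by simp⟩
    · exact ⟨0, zero_mem _, b, hb, by simp⟩
  | add a b ha hb =>
    obtain ⟨x, hx, y, hy, rfl⟩ := ha
    obtain ⟨x', hx', y', hy', rfl⟩ := hb
    exact ⟨x + x', add_mem hx hx', y + y', add_mem hy hy', by abel⟩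

variable {p}

lemma add_pow_of_commute (A : CSAlg k) {a b : A} (h : Commute a b) :
    (a + b) ^ p = a ^ p + b ^ p := by
  obtain ⟨r, hr⟩ := h.exists_add_pow_prime_eq (Fact.out : p.Prime)
  have hp0 : (p : A) = 0 := by
    rw [← map_natCast (algebraMap k A) p, CharP.cast_eq_zero, map_zero]
  rw [hr, hp0]
  simp

lemma pow_eq_even_pow (hp : 2 < p) (A : CSAlg k) {x y : A} (hx : x ∈ A.grading 0)
    (hy : y ∈ A.grading 1) : (x + y) ^ p = x ^ p := by
  rw [A.add_pow_of_commute (A.commute_of_even hx y)]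
  have : y ^ p = 0 := pow_eq_zero_of_le hp.le (by rw [sq, A.mul_self_of_odd hp hy])
  rw [this, add_zero]

lemma frob_add (hp : 2 < p) (A : CSAlg k) (a b : A) : (a + b) ^ p = a ^ p + b ^ p := by
  obtain ⟨x, hx, y, hy, rfl⟩ := A.exists_even_odd a
  obtain ⟨x', hx', y', hy', rfl⟩ := A.exists_even_odd b
  rw [show x + y + (x' + y') = (x + x') + (y + y') by abel,
    A.pow_eq_even_pow hp (add_mem hx hx') (add_mem hy hy'), A.pow_eq_even_pow hp hx hy,
    A.pow_eq_even_pow hp hx' hy', A.add_pow_of_commute (A.commute_of_even hx x')]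

lemma frob_mul (hp : 2 < p) (A : CSAlg k) (a b : A) : (a * b) ^ p = a ^ p * b ^ p := by
  obtain ⟨x, hx, y, hy, rfl⟩ := A.exists_even_odd a
  obtain ⟨x', hx', y', hy', rfl⟩ := A.exists_even_odd b
  have e00 : x * x' ∈ A.grading 0 := SetLike.GradedMul.mul_mem (A := A.grading) hx hx'
  have e11 : y * y' ∈ A.grading 0 := SetLike.GradedMul.mul_mem (A := A.grading) hy hy'
  have e01 : x * y' ∈ A.grading 1 := SetLike.GradedMul.mul_mem (A := A.grading) hx hy'
  have e10 : y * x' ∈ A.grading 1 := SetLike.GradedMul.mul_mem (A := A.grading) hy hx'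
  have hz : (y * y') ^ p = 0 := by
    refine pow_eq_zero_of_le hp.le ?_
    rw [sq, ← mul_assoc, (A.commute_of_even e11 y).eq, ← mul_assoc, A.mul_self_of_odd hp hy]
    simp
  rw [show (x + y) * (x' + y') = (x * x' + y * y') + (x * y' + y * x') by noncomm_ring,
    A.pow_eq_even_pow hp (add_mem e00 e11) (add_mem e01 e10), A.pow_eq_even_pow hp hx hy,
    A.pow_eq_even_pow hp hx' hy', A.add_pow_of_commute (A.commute_of_even e00 _), hz, add_zero,
    (A.commute_of_even hx x').mul_pow]

/-- The `p`-power map, as a morphism of superalgebras `A → A⁽⁻¹⁾`. -/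
def frob (hp : 2 < p) (A : CSAlg k) : Hom A (A.frobTwist p) where
  toFun a := (a ^ p : A.carrier)
  map_one' := one_pow (M := A) p
  map_mul' a b := A.frob_mul hp a b
  map_zero' := zero_pow (M₀ := A) (by omega)
  map_add' a b := A.frob_add hp a b
  commutes' c := (map_pow (algebraMap k A) c p).symm
  map_mem := by
    intro i a ha
    change a ^ p ∈ A.grading i
    have hd : ∀ i : ZMod 2, i = 0 ∨ i = 1 := by decide
    rcases hd i with rfl | rfl
    · simpa using SetLike.pow_mem_graded (A := A.grading) p ha
    · have : a ^ p = 0 := pow_eq_zero_of_le hp.le (by rw [sq, A.mul_self_of_odd hp ha])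
      rw [this]
      exact zero_mem _

end Frobenius

end CSAlg

/-- An affine supergroup scheme over `k`: a functor from commutative superalgebras to groups whose
underlying set-valued functor is `A ↦ Hom(k[G], A)` for a commutative superalgebra `k[G]`
(the coordinate superalgebra `coord`). -/
structure AffineSupergroup (k : Type u) [Field k] where
  coord : CSAlg k
  [group : ∀ A : CSAlg k, Group (CSAlg.Hom coord A)]
  comp_mul : ∀ {A B : CSAlg k} (φ : CSAlg.Hom A B) (g h : CSAlg.Hom coord A),
    φ.comp (g * h) = φ.comp g * φ.comp h

namespace AffineSupergroup

variable {k : Type u} [Field k]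

/-- The group `G(A)` of `A`-points. -/
def Points (G : AffineSupergroup k) (A : CSAlg k) : Type u := CSAlg.Hom G.coord A

instance (G : AffineSupergroup k) (A : CSAlg k) : Group (G.Points A) := G.group A

/-- The functoriality `G(φ) : G(A) → G(B)`. -/
def map (G : AffineSupergroup k) {A B : CSAlg k} (φ : CSAlg.Hom A B) :
    G.Points A →* G.Points B :=
  MonoidHom.mk' (fun g => GradedAlgHom.comp φ g) (fun g h => G.comp_mul φ g h)

/-- The map `G(A) → G'(A)`, `g ↦ g ∘ φ`, induced by a morphism `φ : k[G'] → k[G]`. -/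
def pullback {G G' : AffineSupergroup k} (φ : CSAlg.Hom G'.coord G.coord) {A : CSAlg k}
    (g : G.Points A) : G'.Points A :=
  GradedAlgHom.comp (show CSAlg.Hom G.coord A from g) φ

/-- A homomorphism of affine supergroup schemes `G → G'`, given by its comorphism
`k[G'] → k[G]`. -/
structure Hom (G G' : AffineSupergroup k) where
  comorph : CSAlg.Hom G'.coord G.coord
  mul_comp : ∀ (A : CSAlg k) (g h : G.Points A),
    pullback comorph (g * h) = pullback comorph g * pullback comorph h

/-- The group homomorphism `G(A) → G'(A)` of a homomorphism `G → G'`. -/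
def Hom.app {G G' : AffineSupergroup k} (f : Hom G G') (A : CSAlg k) :
    G.Points A →* G'.Points A :=
  MonoidHom.mk' (pullback f.comorph) (f.mul_comp A)

/-- The composite `G → G' → G''`. -/
def Hom.comp {G G' G'' : AffineSupergroup k} (f' : Hom G' G'') (f : Hom G G') : Hom G G'' where
  comorph := f.comorph.comp f'.comorph
  mul_comp A g h := map_mul ((f'.app A).comp (f.app A)) g h

/-- `G` is algebraic if `k[G]` is finitely generated. -/
def IsAlgebraic (G : AffineSupergroup k) : Prop := Algebra.FiniteType k G.coord

/-- `G` is finite if `k[G]` is finite-dimensional. -/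
def IsFinite (G : AffineSupergroup k) : Prop := Module.Finite k G.coord

/-- `G` is purely even, i.e. an ordinary affine group scheme. -/
def IsPurelyEven (G : AffineSupergroup k) : Prop := G.coord.IsPurelyEven

/-- `G` is an étale group scheme. -/
def IsEtale (G : AffineSupergroup k) : Prop := G.coord.IsEtale

/-- The augmentation `k[G] → k`: the identity element of `G(k)`. -/
def counit (G : AffineSupergroup k) : CSAlg.Hom G.coord (CSAlg.ofComm k k) :=
  (1 : G.Points (CSAlg.ofComm k k))

/-- The augmentation ideal of `k[G]`. -/
def augIdeal (G : AffineSupergroup k) : Ideal G.coord := RingHom.ker G.counit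

/-- `G` is infinitesimal if it is finite with nilpotent augmentation ideal. -/
def IsInfinitesimal (G : AffineSupergroup k) : Prop :=
  G.IsFinite ∧ ∃ n : ℕ, G.augIdeal ^ n = ⊥

/-- The first Frobenius kernel `G₁` of `G`, as a subgroup functor: the kernel of the Frobenius
morphism `G(A) → G⁽¹⁾(A) = G(A⁽⁻¹⁾)` induced by the `p`-power map `A → A⁽⁻¹⁾`. -/
def frobeniusKernel (G : AffineSupergroup k) {p : ℕ} [Fact p.Prime] [CharP k p] (hp : 2 < p)
    (A : CSAlg k) : Subgroup (G.Points A) :=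
  (G.map (A.frob hp)).ker

namespace Hom

/-- `ι : N → G` is a closed embedding, i.e. identifies `N` with a closed subsupergroup scheme
of `G`, whose `A`-points are the range of `N(A) → G(A)`. -/
def IsClosedEmbedding {N G : AffineSupergroup k} (ι : Hom N G) : Prop :=
  Function.Surjective ι.comorph

/-- The image of `ι` is normal: `N(A)` is normal in `G(A)` for all `A`. -/
def IsNormal {N G : AffineSupergroup k} (ι : Hom N G) : Prop :=
  ∀ A : CSAlg k, (ι.app A).range.Normal

/-- `π : G → Q` is the quotient of `G` by the subgroup functor `N`, i.e. it identifies `Q` with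
`G/N`: `π` is faithfully flat with kernel `N`. (Equivalently, `Q` represents the sheaf associated
with `A ↦ G(A)/N(A)` for the faithfully flat topology.) -/
structure IsQuotient {G Q : AffineSupergroup k} (π : Hom G Q)
    (N : ∀ A : CSAlg k, Subgroup (G.Points A)) : Prop where
  ker_eq : ∀ A : CSAlg k, (π.app A).ker = N A
  faithfullyFlat : CSAlg.IsFaithfullyFlat π.comorph

/-- `ρ : H → P` is the maximal étale quotient group of `H`, i.e. identifies `P` with the component
group `π₀(H)`: `P` is an étale quotient of `H`, and every homomorphism from `H` to an étale group
scheme factors uniquely through `ρ`. -/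
structure IsComponentGroup {H P : AffineSupergroup k} (ρ : Hom H P) : Prop where
  etale : P.IsEtale
  faithfullyFlat : CSAlg.IsFaithfullyFlat ρ.comorph
  factor : ∀ (E : AffineSupergroup k), E.IsEtale → ∀ f : Hom H E, ∃! f' : Hom P E, f'.comp ρ = f

end Hom

/-- `G ≅ N ⋊ Q` compatibly with given `ι : N → G` and `π : G → Q`: there are a functorial action
`α` of `Q` on `N` by group automorphisms and a functorial group isomorphism
`G(A) ≅ N(A) ⋊ Q(A)`, under which `ι` is the inclusion of `N` and `π` the projection to `Q`. -/
def IsSemidirectProduct {N G Q : AffineSupergroup k} (ι : Hom N G) (π : Hom G Q) : Prop :=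
  ∃ (α : ∀ A : CSAlg k, Q.Points A →* MulAut (N.Points A))
    (e : ∀ A : CSAlg k, G.Points A ≃* N.Points A ⋊[α A] Q.Points A),
    (∀ (A B : CSAlg k) (φ : CSAlg.Hom A B) (x : Q.Points A) (n : N.Points A),
      N.map φ (α A x n) = α B (Q.map φ x) (N.map φ n)) ∧
    (∀ (A B : CSAlg k) (φ : CSAlg.Hom A B) (g : G.Points A),
      e B (G.map φ g) = ⟨N.map φ (e A g).left, Q.map φ (e A g).right⟩) ∧
    (∀ (A : CSAlg k) (n : N.Points A), e A (ι.app A n) = SemidirectProduct.inl n) ∧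
    (∀ (A : CSAlg k) (g : G.Points A), (e A g).right = π.app A g)

end AffineSupergroup

/-! Write `A = k[G]`, and for `n ≥ 1` let `B_n` be the set of `p ^ n`-th powers in `A`. As `p > 2`,
odd elements square to zero, so the `p`-power map is a ring homomorphism that kills the odd part.
Hence `B_n` consists of powers of even elements, and it is a `k`-subalgebra because `k` is perfect.
It is a sub-Hopf-algebra because comultiplication and antipode are algebra maps and the `p ^ n`-th
power of a sum of tensors `a ⊗ b` is the sum of the tensors of the powers. The kernel of `G → Spec
B_1` is `G₁`, so `Spec B_1` is the candidate for `G/G₁`.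

Faithful flatness of `B = B_1 ⊆ A` comes from a torsor argument. `A` is finite over `B`, and the
shear `(g, h) ↦ (g, gh)` gives `A ⊗_B A ≅ A ⊗_k (A / A B⁺)`, so `A ⊗_B A` is a finite power of `A`
(`torsorMap_bijective`). A finite module with this property and with a vector of zero annihilator is
projective over a Noetherian ring (`Module.Projective.of_tensor_self_equiv_pi`).

Let `D` be the intersection of all `B_n`. It is again a sub-Hopf-algebra, since the subspaces `B_n ⊗
B_n` intersect in `D ⊗ D`. Krull's intersection theorem shows that `D` is reduced and
finite-dimensional, hence étale. Elements of an étale algebra are `p ^ n`-th powers for every `n`,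
so every homomorphism to an étale group scheme has comorphism with values in `D`. Thus `Spec D =
π₀(G)`, and `G⁰` is the kernel of `G → Spec D`. Flatness over `D` is automatic because `D` is
semisimple.

If `G` is finite, then `B_n = D` for large `n`. Sending `a` to the `p ^ n`-th root of `a ^ p ^ n` in
`D` retracts `A` onto `D`, and since `D ⊗ D` is reduced this retraction is a group section of `G →
π₀(G)`, which splits the extension. If `a` lies in the augmentation ideal, then `a ^ p ^ n` lies in
that of `D` and vanishes on `G⁰`. So the augmentation ideal of `k[G⁰]` is nil, and nilpotent by
finiteness. -/

namespace CSAlg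

variable {k : Type u} [Field k]

/-! ### Superalgebra gradings as eigenspaces of an involution, away from characteristic two. -/

section Involution

variable {A : Type u} [Ring A] [Algebra k A]

/-- The grading by the eigenspaces of an involution. -/
def involutionGrading (σ : A →ₐ[k] A) (i : ZMod 2) : Submodule k A :=
  LinearMap.ker (σ.toLinearMap - (-1 : k) ^ i.val • LinearMap.id)

lemma mem_involutionGrading {σ : A →ₐ[k] A} {i : ZMod 2} {a : A} :
    a ∈ involutionGrading σ i ↔ σ a = (-1 : k) ^ i.val • a := by
  simp [involutionGrading, sub_eq_zero]

lemma neg_one_pow_val_add (i j : ZMod 2) :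
    (-1 : k) ^ (i + j).val = (-1 : k) ^ i.val * (-1 : k) ^ j.val := by
  rw [← pow_add, ZMod.val_add, ← neg_one_pow_eq_pow_mod_two]

lemma zmod_two_cases (i : ZMod 2) : i = 0 ∨ i = 1 := by
  revert i; decide

/-- The projection to an eigenspace of an involution. -/
def involutionProj (σ : A →ₐ[k] A) (hσ : ∀ a, σ (σ a) = a) (i : ZMod 2) :
    A →ₗ[k] involutionGrading σ i :=
  LinearMap.codRestrict _ ((2 : k)⁻¹ • (LinearMap.id + (-1 : k) ^ i.val • σ.toLinearMap)) (by
    intro a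
    rw [mem_involutionGrading]
    simp only [LinearMap.smul_apply, LinearMap.add_apply, LinearMap.id_apply,
      AlgHom.toLinearMap_apply, map_smul, map_add, hσ]
    rw [smul_comm, smul_add ((-1 : k) ^ i.val), smul_smul ((-1 : k) ^ i.val) ((-1 : k) ^ i.val),
      ← pow_add, ← two_mul, pow_mul]
    simp [add_comm])

lemma involutionProj_coe (σ : A →ₐ[k] A) (hσ : ∀ a, σ (σ a) = a) (i : ZMod 2) (a : A) :
    (involutionProj σ hσ i a : A) = (2 : k)⁻¹ • (a + (-1 : k) ^ i.val • σ a) := rfl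

lemma val_one_two : (1 : ZMod 2).val = 1 := rfl

/-- The `ℤ/2`-grading defined by an involution, in characteristic different from two. -/
@[reducible] def involutionGraded (h2 : (2 : k) ≠ 0) (σ : A →ₐ[k] A) (hσ : ∀ a, σ (σ a) = a) :
    GradedAlgebra (involutionGrading σ) :=
  { DirectSum.Decomposition.ofLinearMap (involutionGrading σ)
      ((DirectSum.lof k (ZMod 2) (fun i => involutionGrading σ i) 0).comp (involutionProj σ hσ 0) +
        (DirectSum.lof k (ZMod 2) (fun i => involutionGrading σ i) 1).comp (involutionProj σ hσ 1))
      (by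
        ext a
        simp only [LinearMap.comp_apply, LinearMap.add_apply, map_add,
          DirectSum.coeLinearMap_lof, LinearMap.id_apply, involutionProj_coe, ZMod.val_zero,
          val_one_two, pow_zero, pow_one, one_smul, neg_smul]
        rw [← smul_add, add_add_add_comm, add_neg_cancel, add_zero, ← two_smul k, smul_smul,
          inv_mul_cancel₀ h2, one_smul])
      (by
        ext i x : 2
        have key : ∀ j, (involutionProj σ hσ j (x : A) : A) = if j = i then (x : A) else 0 := by
          intro j
          rw [involutionProj_coe, mem_involutionGrading.1 x.2, smul_smul]
          rcases zmod_two_cases i with rfl | rfl <;> rcases zmod_two_cases j with rfl | rfl <;>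
            simp [val_one_two, ← two_smul k, smul_smul, inv_mul_cancel₀ h2]
        simp only [LinearMap.comp_apply, LinearMap.add_apply, DirectSum.coeLinearMap_lof,
          LinearMap.id_apply]
        rcases zmod_two_cases i with rfl | rfl
        · have h0 : involutionProj σ hσ 0 (x : A) = x := Subtype.ext (by simp [key])
          have h1 : involutionProj σ hσ 1 (x : A) = 0 := Subtype.ext (by simp [key])
          rw [h0, h1, map_zero, add_zero]
        · have h0 : involutionProj σ hσ 0 (x : A) = 0 := Subtype.ext (by simp [key])
          have h1 : involutionProj σ hσ 1 (x : A) = x := Subtype.ext (by simp [key])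
          rw [h0, h1, map_zero, zero_add]) with
    one_mem := by simp [mem_involutionGrading]
    mul_mem := by
      intro i j a b ha hb
      rw [mem_involutionGrading] at *
      rw [map_mul, ha, hb, smul_mul_smul_comm, neg_one_pow_val_add] }

end Involution

/-- The linear map underlying the parity involution. -/
def parityLin (A : CSAlg k) : A →ₗ[k] A :=
  DirectSum.toModule k (ZMod 2) A (fun i => (-1 : k) ^ i.val • (A.grading i).subtype) ∘ₗ
    (DirectSum.decomposeLinearEquiv A.grading).toLinearMap

lemma parityLin_of_mem (A : CSAlg k) {i : ZMod 2} {a : A} (ha : a ∈ A.grading i) :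
    A.parityLin a = (-1 : k) ^ i.val • a := by
  simp only [parityLin, LinearMap.comp_apply]
  have : (DirectSum.decomposeLinearEquiv A.grading).toLinearMap a =
      DirectSum.lof k (ZMod 2) (fun i => A.grading i) i ⟨a, ha⟩ := by
    exact DirectSum.decompose_of_mem A.grading ha
  rw [this, DirectSum.toModule_lof]
  rfl

/-- The parity involution of a superalgebra. -/
def parity (A : CSAlg k) : A →ₐ[k] A :=
  AlgHom.ofLinearMap A.parityLin
    (by rw [A.parityLin_of_mem (SetLike.GradedOne.one_mem (A := A.grading))]; simp)
    (by
      have hom : ∀ {i j : ZMod 2} {a b : A}, a ∈ A.grading i → b ∈ A.grading j →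
          A.parityLin (a * b) = A.parityLin a * A.parityLin b := by
        intro i j a b ha hb
        rw [A.parityLin_of_mem ha, A.parityLin_of_mem hb,
          A.parityLin_of_mem (SetLike.GradedMul.mul_mem (A := A.grading) ha hb),
          smul_mul_smul_comm, neg_one_pow_val_add]
      intro a b
      obtain ⟨x, hx, y, hy, rfl⟩ := A.exists_even_odd a
      obtain ⟨x', hx', y', hy', rfl⟩ := A.exists_even_odd b
      simp only [mul_add, add_mul, map_add, hom hx hx', hom hx hy', hom hy hx', hom hy hy'])

lemma parity_of_mem (A : CSAlg k) {i : ZMod 2} {a : A} (ha : a ∈ A.grading i) :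
    A.parity a = (-1 : k) ^ i.val • a :=
  A.parityLin_of_mem ha

lemma parity_parity (A : CSAlg k) (a : A) : A.parity (A.parity a) = a := by
  obtain ⟨x, hx, y, hy, rfl⟩ := A.exists_even_odd a
  simp [A.parity_of_mem hx, A.parity_of_mem hy, val_one_two]

/-- Parity acts by opposite signs on the two components, and `2 ≠ 0` separates the signs. Evenness
of an algebra map thereby becomes commutation with parity, as used in `Hom.ofParity`. -/
lemma mem_grading_iff (h2 : (2 : k) ≠ 0) (A : CSAlg k) {i : ZMod 2} {a : A} :
    a ∈ A.grading i ↔ A.parity a = (-1 : k) ^ i.val • a := by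
  refine ⟨A.parity_of_mem, fun h => ?_⟩
  obtain ⟨x, hx, y, hy, rfl⟩ := A.exists_even_odd a
  rw [map_add, A.parity_of_mem hx, A.parity_of_mem hy] at h
  rcases zmod_two_cases i with rfl | rfl
  · have : (2 : k) • y = 0 := by
      simp only [val_one_two, ZMod.val_zero, pow_zero, one_smul, pow_one, neg_smul] at h
      rw [two_smul]
      nth_rewrite 1 [← neg_eq_iff_add_eq_zero.2 (show -y + y = 0 by simp)]
      have := add_left_cancel h
      rw [neg_neg]
      nth_rewrite 1 [← this]
      simp
    rw [(smul_eq_zero.1 this).resolve_left h2, add_zero]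
    exact hx
  · have : (2 : k) • x = 0 := by
      simp only [val_one_two, ZMod.val_zero, pow_zero, one_smul, pow_one, neg_smul, neg_add] at h
      have := add_right_cancel h
      rw [two_smul]
      nth_rewrite 1 [this]
      simp
    rw [(smul_eq_zero.1 this).resolve_left h2, zero_add]
    exact hy

lemma Hom.map_mem_grading {A B : CSAlg k} (f : Hom A B) {i : ZMod 2} {a : A}
    (ha : a ∈ A.grading i) : f a ∈ B.grading i :=
  f.map_mem ha

lemma Hom.map_parity {A B : CSAlg k} (f : Hom A B) (a : A) : f (A.parity a) = B.parity (f a) := by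
  obtain ⟨x, hx, y, hy, rfl⟩ := A.exists_even_odd a
  simp only [map_add, A.parity_of_mem hx, A.parity_of_mem hy,
      B.parity_of_mem (f.map_mem_grading hx),
    B.parity_of_mem (f.map_mem_grading hy), map_smul]

/-- An algebra homomorphism commuting with the parity involutions is even. -/
def Hom.ofParity (h2 : (2 : k) ≠ 0) {A B : CSAlg k} (f : A →ₐ[k] B)
    (hf : ∀ a, f (A.parity a) = B.parity (f a)) : Hom A B where
  toAlgHom := f
  map_mem := by
    intro i a ha
    change f a ∈ B.grading i
    rw [mem_grading_iff h2, ← hf, A.parity_of_mem ha, map_smul]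

/-! ### The super tensor product as coproduct of commutative superalgebras. -/

section Tensor

open TensorProduct GradedTensorProduct

variable (A B : CSAlg k)

/-- The underlying algebra of the super tensor product. -/
abbrev TensorCarrier : Type u := GradedTensorProduct k A.grading B.grading

lemma neg_one_zpow_smul {M : Type*} [AddCommGroup M] [Module k M] (i : ZMod 2) (m : M) :
    ((-1 : ℤˣ) ^ i) • m = (-1 : k) ^ i.val • m := by
  rcases zmod_two_cases i with rfl | rfl
  · simp
  · rw [uzpow_one, val_one_two]
    simp

lemma inl_mul_inr_comm {i j : ZMod 2} {a : A} {b : B} (ha : a ∈ A.grading i)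
    (hb : b ∈ B.grading j) :
    (includeRight A.grading B.grading b * includeLeft A.grading B.grading a : TensorCarrier A B) =
      (-1 : k) ^ (j * i).val • (includeLeft A.grading B.grading a *
        includeRight A.grading B.grading b) := by
  simp only [includeRight_apply, includeLeft_apply]
  rw [tmul_one_mul_one_tmul]
  have := tmul_coe_mul_coe_tmul (R := k) A.grading B.grading 1 ⟨b, hb⟩ ⟨a, ha⟩ 1
  simp only [one_mul, mul_one] at this
  rw [this, neg_one_zpow_smul (k := k)]

lemma neg_one_pow_mul_self (n : ℕ) : (-1 : k) ^ n * (-1 : k) ^ n = 1 := by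
  rw [← pow_add, ← two_mul, pow_mul]; simp

/-- The parity involution of the super tensor product. -/
noncomputable def tensorParity : TensorCarrier A B →ₐ[k] TensorCarrier A B :=
  GradedTensorProduct.lift A.grading B.grading
    ((includeLeft A.grading B.grading).comp A.parity)
    ((includeRight A.grading B.grading).comp B.parity) (by
      intro i j a b
      simp only [AlgHom.comp_apply, A.parity_of_mem a.2, B.parity_of_mem b.2, map_smul]
      rw [neg_one_zpow_smul (k := k), smul_mul_smul_comm, smul_mul_smul_comm,
        inl_mul_inr_comm A B a.2 b.2, smul_smul, smul_smul]
      congr 1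
      -- The two Koszul signs are equal and cancel.
      have := neg_one_pow_mul_self (k := k) (j * i).val
      linear_combination (-(-1 : k) ^ i.val * (-1 : k) ^ j.val) * this)

lemma tensorParity_tmul {i j : ZMod 2} {a : A} {b : B} (ha : a ∈ A.grading i)
    (hb : b ∈ B.grading j) :
    tensorParity A B (a ᵍ⊗ₜ[k] b) = (-1 : k) ^ (i + j).val • (a ᵍ⊗ₜ[k] b) := by
  rw [tensorParity, lift_tmul]
  simp only [AlgHom.comp_apply, A.parity_of_mem ha, B.parity_of_mem hb, map_smul]
  rw [smul_mul_smul_comm, neg_one_pow_val_add]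
  simp only [includeRight_apply, includeLeft_apply]
  rw [tmul_one_mul_one_tmul]

lemma tensor_induction {P : TensorCarrier A B → Prop} (add : ∀ x y, P x → P y → P (x + y))
    (tmul : ∀ {i j : ZMod 2} {a : A} {b : B}, a ∈ A.grading i → b ∈ B.grading j →
      P (a ᵍ⊗ₜ[k] b)) (x : TensorCarrier A B) : P x := by
  have zero : P 0 := by
    have := tmul (zero_mem (A.grading 0)) (zero_mem (B.grading 0))
    rwa [GradedTensorProduct.tmul, TensorProduct.tmul_zero, map_zero] at this
  refine TensorProduct.induction_on (motive := fun t => P (of k A.grading B.grading t))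
    ((of k A.grading B.grading).symm x) ?_ ?_ ?_
  · simpa using zero
  · intro a b
    obtain ⟨x, hx, y, hy, rfl⟩ := A.exists_even_odd a
    obtain ⟨x', hx', y', hy', rfl⟩ := B.exists_even_odd b
    simp only [TensorProduct.add_tmul, TensorProduct.tmul_add, map_add]
    exact add _ _ (add _ _ (tmul hx hx') (tmul hy hx')) (add _ _ (tmul hx hy') (tmul hy hy'))
  · intro x y hx hy
    rw [map_add]
    exact add _ _ hx hy

lemma tensorParity_tensorParity (x : TensorCarrier A B) :
    tensorParity A B (tensorParity A B x) = x := by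
  induction x using tensor_induction with
  | add x y hx hy => rw [map_add, map_add, hx, hy]
  | tmul ha hb =>
    rw [tensorParity_tmul A B ha hb, map_smul, tensorParity_tmul A B ha hb, smul_smul,
      neg_one_pow_mul_self, one_smul]

/-- The operator `1 + (-1) ^ i • parity` doubles homogeneous pure tensors of total degree `i` and
kills the others, while on the eigenspace it is multiplication by `2`. Supercommutativity can then
be checked on homogeneous pure tensors. -/
lemma involutionGrading_le_span (h2 : (2 : k) ≠ 0) (i : ZMod 2) :
    involutionGrading (tensorParity A B) i ≤ Submodule.span k
      {t | ∃ r s, r + s = i ∧ ∃ a ∈ A.grading r, ∃ b ∈ B.grading s, t = a ᵍ⊗ₜ[k] b} := by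
  have key : ∀ x : TensorCarrier A B, x + (-1 : k) ^ i.val • tensorParity A B x ∈
      Submodule.span k
        {t | ∃ r s, r + s = i ∧ ∃ a ∈ A.grading r, ∃ b ∈ B.grading s, t = a ᵍ⊗ₜ[k] b} := by
    intro x
    induction x using tensor_induction with
    | add x y hx hy =>
      have := add_mem hx hy
      rwa [add_add_add_comm, ← smul_add, ← map_add] at this
    | @tmul r s a b ha hb =>
      rw [tensorParity_tmul A B ha hb, smul_smul]
      by_cases h : r + s = i
      · exact add_mem (Submodule.subset_span ⟨r, s, h, a, ha, b, hb, rfl⟩)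
          (Submodule.smul_mem _ _ (Submodule.subset_span ⟨r, s, h, a, ha, b, hb, rfl⟩))
      · have : (-1 : k) ^ i.val * (-1 : k) ^ (r + s).val = -1 := by
          generalize r + s = j at h
          rcases zmod_two_cases i with rfl | rfl <;> rcases zmod_two_cases j with rfl | rfl <;>
            simp_all [val_one_two]
        rw [this]
        simp
  intro x hx
  have := key x
  rw [mem_involutionGrading.1 hx, smul_smul, neg_one_pow_mul_self, one_smul, ← two_smul k] at this
  exact (Submodule.smul_mem_iff _ h2).1 this

lemma tmul_mul_tmul_comm {r s r' s' : ZMod 2} {a a' : A} {b b' : B} (ha : a ∈ A.grading r)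
    (hb : b ∈ B.grading s) (ha' : a' ∈ A.grading r') (hb' : b' ∈ B.grading s') :
    (a ᵍ⊗ₜ[k] b * a' ᵍ⊗ₜ[k] b' : TensorCarrier A B) =
      (-1 : k) ^ ((r + s).val * (r' + s').val) • (a' ᵍ⊗ₜ[k] b' * a ᵍ⊗ₜ[k] b) := by
  have e1 := tmul_coe_mul_coe_tmul (R := k) A.grading B.grading a ⟨b, hb⟩ ⟨a', ha'⟩ b'
  have e2 := tmul_coe_mul_coe_tmul (R := k) A.grading B.grading a' ⟨b', hb'⟩ ⟨a, ha⟩ b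
  simp only at e1 e2
  have key : ∀ {C : CSAlg k} {i j : ZMod 2} {c d : C}, c ∈ C.grading i → d ∈ C.grading j →
      c * d = (-1 : k) ^ (i.val * j.val) • (d * c) := by
    intro C i j c d hc hd
    rw [C.comm hc hd]
    rcases zmod_two_cases i with rfl | rfl <;> rcases zmod_two_cases j with rfl | rfl <;>
      simp [val_one_two]
  rw [e1, e2, neg_one_zpow_smul (k := k), neg_one_zpow_smul (k := k), key ha ha', key hb hb',
    GradedTensorProduct.tmul, ← TensorProduct.smul_tmul', TensorProduct.tmul_smul]
  simp only [map_smul, smul_smul]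
  congr 1
  rcases zmod_two_cases r with rfl | rfl <;> rcases zmod_two_cases s with rfl | rfl <;>
    rcases zmod_two_cases r' with rfl | rfl <;> rcases zmod_two_cases s' with rfl | rfl <;>
    simp [val_one_two, show (1 + 1 : ZMod 2) = 0 from rfl]

/-- The super tensor product, which is the coproduct of commutative superalgebras. -/
noncomputable def tensor (h2 : (2 : k) ≠ 0) : CSAlg k where
  carrier := TensorCarrier A B
  grading := involutionGrading (tensorParity A B)
  graded := involutionGraded h2 _ (tensorParity_tensorParity A B)
  comm := by
    intro i j x y hx hy
    replace hx := involutionGrading_le_span A B h2 i hx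
    replace hy := involutionGrading_le_span A B h2 j hy
    have hc : ∀ (n : ℕ) (z : TensorCarrier A B), (-1) ^ n * z = (-1 : k) ^ n • z := by
      intro n z
      rw [Algebra.smul_def, map_pow, map_neg, map_one]
    rw [hc]
    induction hx using Submodule.span_induction with
    | zero => simp
    | add x x' _ _ hx hx' => rw [add_mul, mul_add, smul_add, hx, hx']
    | smul c x _ hx => rw [smul_mul_assoc, hx, mul_smul_comm, smul_comm]
    | mem x hx =>
      obtain ⟨r, s, rfl, a, ha, b, hb, rfl⟩ := hx
      induction hy using Submodule.span_induction with
      | zero => simp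
      | add x x' _ _ hx hx' => rw [add_mul, mul_add, smul_add, hx, hx']
      | smul c x _ hx => rw [smul_mul_assoc, mul_smul_comm, hx, smul_comm]
      | mem y hy =>
        obtain ⟨r', s', rfl, a', ha', b', hb', rfl⟩ := hy
        exact tmul_mul_tmul_comm A B ha hb ha' hb'

end Tensor
end CSAlg

namespace CSAlg

variable {k : Type u} [Field k]

section Tensor

open TensorProduct

variable (h2 : (2 : k) ≠ 0) (A B : CSAlg k)

/-- The first inclusion into the super tensor product. -/
noncomputable def inl : Hom A (A.tensor B h2) where
  toAlgHom := GradedTensorProduct.includeLeft A.grading B.grading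
  map_mem := by
    intro i x hx
    have := tensorParity_tmul A B hx (SetLike.GradedOne.one_mem (A := B.grading))
    rw [add_zero] at this
    exact mem_involutionGrading.2 this

/-- The second inclusion into the super tensor product. -/
noncomputable def inr : Hom B (A.tensor B h2) where
  toAlgHom := GradedTensorProduct.includeRight A.grading B.grading
  map_mem := by
    intro i x hx
    have := tensorParity_tmul A B (SetLike.GradedOne.one_mem (A := A.grading)) hx
    rw [zero_add] at this
    exact mem_involutionGrading.2 this

/-- The underlying vector space of the super tensor product. -/
noncomputable def tensorEquiv : A ⊗[k] B ≃ₗ[k] A.tensor B h2 :=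
  GradedTensorProduct.of k A.grading B.grading

lemma tensorEquiv_tmul (a : A) (b : B) :
    tensorEquiv h2 A B (a ⊗ₜ b) = inl h2 A B a * inr h2 A B b :=
  (GradedTensorProduct.tmul_one_mul_one_tmul A.grading B.grading a b).symm

variable {A B}

lemma tensor_span_induction {P : A.tensor B h2 → Prop} (add : ∀ x y, P x → P y → P (x + y))
    (mul : ∀ a b, P (inl h2 A B a * inr h2 A B b)) (x : A.tensor B h2) : P x := by
  obtain ⟨t, rfl⟩ := (tensorEquiv h2 A B).surjective x
  induction t using TensorProduct.induction_on with
  | zero => simpa using mul 0 0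
  | tmul a b => rw [tensorEquiv_tmul]; exact mul a b
  | add x y hx hy => rw [map_add]; exact add _ _ hx hy

lemma tensor_hom_ext {C : CSAlg k} {f g : Hom (A.tensor B h2) C}
    (hl : ∀ a, f (inl h2 A B a) = g (inl h2 A B a))
    (hr : ∀ b, f (inr h2 A B b) = g (inr h2 A B b)) : f = g := by
  ext x
  induction x using tensor_span_induction with
  | add x y hx hy => rw [map_add, map_add, hx, hy]
  | mul a b => rw [map_mul, map_mul, hl, hr]

/-- The algebra homomorphism out of the super tensor product given by a pair of morphisms. -/
noncomputable def tensorLiftAlgHom {C : CSAlg k} (f : Hom A C) (g : Hom B C) :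
    A.tensor B h2 →ₐ[k] C :=
  GradedTensorProduct.lift A.grading B.grading f.toAlgHom g.toAlgHom (by
    intro i j a b
    rw [neg_one_zpow_smul (k := k)]
    change f a * g b = _ • (g b * f a)
    rw [C.comm (f.map_mem_grading a.2) (g.map_mem_grading b.2)]
    rcases zmod_two_cases i with rfl | rfl <;> rcases zmod_two_cases j with rfl | rfl <;>
      simp [val_one_two])

lemma tensorLiftAlgHom_inl {C : CSAlg k} (f : Hom A C) (g : Hom B C) (a : A) :
    tensorLiftAlgHom h2 f g (inl h2 A B a) = f a := by
  change f a * g 1 = f a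
  rw [map_one, mul_one]

lemma tensorLiftAlgHom_inr {C : CSAlg k} (f : Hom A C) (g : Hom B C) (b : B) :
    tensorLiftAlgHom h2 f g (inr h2 A B b) = g b := by
  change f 1 * g b = g b
  rw [map_one, one_mul]

/-- The morphism out of the super tensor product given by a pair of morphisms. -/
noncomputable def tensorLift {C : CSAlg k} (f : Hom A C) (g : Hom B C) :
    Hom (A.tensor B h2) C :=
  Hom.ofParity h2 (tensorLiftAlgHom h2 f g) (by
    intro x
    induction x using tensor_span_induction with
    | add x y hx hy => rw [map_add, map_add, map_add, map_add, hx, hy]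
    | mul a b =>
      rw [map_mul, map_mul, ← Hom.map_parity, ← Hom.map_parity, map_mul, map_mul,
        tensorLiftAlgHom_inl, tensorLiftAlgHom_inl, tensorLiftAlgHom_inr, tensorLiftAlgHom_inr,
        ← Hom.map_parity, ← Hom.map_parity])

@[simp] lemma tensorLift_inl {C : CSAlg k} (f : Hom A C) (g : Hom B C) (a : A) :
    tensorLift h2 f g (inl h2 A B a) = f a :=
  tensorLiftAlgHom_inl h2 f g a

@[simp] lemma tensorLift_inr {C : CSAlg k} (f : Hom A C) (g : Hom B C) (b : B) :
    tensorLift h2 f g (inr h2 A B b) = g b :=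
  tensorLiftAlgHom_inr h2 f g b

end Tensor

/-! ### Quotients of superalgebras by ideals with even generators. -/

section Quotient

variable (h2 : (2 : k) ≠ 0) (A : CSAlg k) (s : Set A) (hs : s ⊆ A.grading 0)

include hs in
-- `Ideal` means left ideal here; the generators are central because they are even.
lemma isTwoSided_span : (Ideal.span s).IsTwoSided := by
  refine ⟨fun {a} b ha => ?_⟩
  induction ha using Submodule.span_induction with
  | mem x hx =>
    rw [(A.commute_of_even (hs hx) b).eq]
    exact Ideal.mul_mem_left _ _ (Ideal.subset_span hx)
  | zero => simp
  | add x y _ _ hx hy => rw [add_mul]; exact add_mem hx hy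
  | smul c x _ hx => rw [smul_eq_mul, mul_assoc]; exact Ideal.mul_mem_left _ _ hx

include hs in
lemma parity_mem_span {a : A} (ha : a ∈ Ideal.span s) : A.parity a ∈ Ideal.span s := by
  induction ha using Submodule.span_induction with
  | mem x hx =>
    rw [A.parity_of_mem (hs hx)]
    simpa using Ideal.subset_span hx
  | zero => simp
  | add x y _ _ hx hy => rw [map_add]; exact add_mem hx hy
  | smul c x _ hx => rw [smul_eq_mul, map_mul]; exact Ideal.mul_mem_left _ _ hx

/-- The quotient of a superalgebra by the ideal generated by a set of even elements. -/
noncomputable def quot : CSAlg k :=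
  haveI := A.isTwoSided_span s hs
  let σ : (A ⧸ Ideal.span s) →ₐ[k] (A ⧸ Ideal.span s) :=
    Ideal.Quotient.liftₐ _ ((Ideal.Quotient.mkₐ k _).comp A.parity) (by
      intro a ha
      exact Ideal.Quotient.eq_zero_iff_mem.2 (A.parity_mem_span s hs ha))
  have hσ1 : ∀ a : A, σ (Ideal.Quotient.mk _ a) = Ideal.Quotient.mk _ (A.parity a) := fun a => rfl
  have hσ : ∀ a, σ (σ a) = a := by
    intro a
    obtain ⟨a, rfl⟩ := Ideal.Quotient.mk_surjective a
    rw [hσ1, hσ1, A.parity_parity]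
  { carrier := A ⧸ Ideal.span s
    grading := involutionGrading σ
    graded := involutionGraded h2 σ hσ
    comm := by
      -- A homogeneous class has a homogeneous representative: average any representative with its
      -- signed parity conjugate.
      have key : ∀ (i : ZMod 2) (a : A ⧸ Ideal.span s), a ∈ involutionGrading σ i →
          ∃ b ∈ A.grading i, Ideal.Quotient.mk _ b = a := by
        intro i a ha
        obtain ⟨a, rfl⟩ := Ideal.Quotient.mk_surjective a
        rw [mem_involutionGrading, hσ1] at ha
        refine ⟨(2 : k)⁻¹ • (a + (-1 : k) ^ i.val • A.parity a), ?_, ?_⟩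
        · rw [mem_grading_iff h2, map_smul, map_add, map_smul, A.parity_parity, smul_comm,
            smul_add ((-1 : k) ^ i.val), smul_smul, neg_one_pow_mul_self, one_smul, add_comm]
        · have : Ideal.Quotient.mk (Ideal.span s)
              ((2 : k)⁻¹ • (a + (-1 : k) ^ i.val • A.parity a)) =
              (2 : k)⁻¹ • (Ideal.Quotient.mk (Ideal.span s) a +
                (-1 : k) ^ i.val • Ideal.Quotient.mk (Ideal.span s) (A.parity a)) := rfl
          rw [this, ha, smul_smul, neg_one_pow_mul_self, one_smul, ← two_smul k, smul_smul,
            inv_mul_cancel₀ h2, one_smul]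
      intro i j a b ha hb
      obtain ⟨a, ha', rfl⟩ := key i a ha
      obtain ⟨b, hb', rfl⟩ := key j b hb
      rw [← map_mul, A.comm ha' hb']
      simp }

/-- The quotient map. -/
noncomputable def quotMk : Hom A (A.quot h2 s hs) :=
  haveI := A.isTwoSided_span s hs
  { toAlgHom := Ideal.Quotient.mkₐ k (Ideal.span s)
    map_mem := by
      intro i a ha
      refine mem_involutionGrading.2 ?_
      change Ideal.Quotient.mk (Ideal.span s) (A.parity a) = _
      rw [A.parity_of_mem ha]
      rfl }

lemma quotMk_surjective : Function.Surjective (A.quotMk h2 s hs) :=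
  haveI := A.isTwoSided_span s hs
  Ideal.Quotient.mk_surjective

lemma quotMk_eq_zero_iff {a : A} : A.quotMk h2 s hs a = 0 ↔ a ∈ Ideal.span s :=
  haveI := A.isTwoSided_span s hs
  Ideal.Quotient.eq_zero_iff_mem

/-- The morphism out of a quotient. -/
noncomputable def quotLift {B : CSAlg k} (f : Hom A B) (hf : ∀ a ∈ s, f a = 0) :
    Hom (A.quot h2 s hs) B :=
  haveI := A.isTwoSided_span s hs
  have hf' : ∀ a ∈ Ideal.span s, f a = 0 := fun a ha => by
    have : Ideal.span s ≤ RingHom.ker (f : A →+* B) := Ideal.span_le.2 hf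
    exact this ha
  Hom.ofParity h2 (A := A.quot h2 s hs) (Ideal.Quotient.liftₐ (Ideal.span s) f.toAlgHom hf') (by
    intro a
    obtain ⟨a, rfl⟩ := A.quotMk_surjective h2 s hs a
    rw [← Hom.map_parity]
    exact f.map_parity a)

end Quotient

lemma Hom.cancel_inj {A B C : CSAlg k} {f : Hom B C} (hf : Function.Injective f) {x y : Hom A B}
    (h : f.comp x = f.comp y) : x = y :=
  (GradedAlgHom.cancel_left hf).1 h

/-- A morphism into `A` whose values lie in the range of an injective morphism lifts. -/
lemma exists_comp_eq (h2 : (2 : k) ≠ 0) {A B C : CSAlg k} {f : Hom B A} {g : Hom C A}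
    (hg : Function.Injective g) (h : ∀ s, ∃ t, g t = f s) : ∃ e : Hom B C, g.comp e = f := by
  let e : B →ₐ[k] C := ((AlgEquiv.ofInjective g.toAlgHom hg).symm.toAlgHom).comp
    (f.toAlgHom.codRestrict g.toAlgHom.range (fun s => h s))
  have he : ∀ s, g (e s) = f s := fun s =>
    congrArg Subtype.val ((AlgEquiv.ofInjective g.toAlgHom hg).apply_symm_apply
      (f.toAlgHom.codRestrict g.toAlgHom.range (fun s => h s) s))
  refine ⟨Hom.ofParity h2 e fun s => hg ?_, GradedAlgHom.ext he⟩
  rw [he, g.map_parity, he, f.map_parity]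

/-! ### Morphisms out of purely even superalgebras and their tensor products. -/

section OfComm

variable {S S' : Type u} [CommRing S] [Algebra k S] [CommRing S'] [Algebra k S']

lemma mem_ofComm_zero (s : S) : s ∈ (ofComm k S).grading 0 := by
  simp [evenGrading]

/-- An algebra homomorphism with even values, as a morphism out of a purely even superalgebra. -/
def ofCommHom {A : CSAlg k} (f : S →ₐ[k] A) (hf : ∀ s, f s ∈ A.grading 0) : Hom (ofComm k S) A where
  toAlgHom := f
  map_mem := by
    intro i a ha
    rcases zmod_two_cases i with rfl | rfl
    · exact hf a
    · have : a = 0 := by simpa [evenGrading] using ha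
      rw [this]
      simp

lemma ofComm_hom_even {A : CSAlg k} (f : Hom (ofComm k S) A) (s : S) : f s ∈ A.grading 0 :=
  f.map_mem_grading (mem_ofComm_zero s)

/-- A homomorphism of commutative algebras, as a morphism of purely even superalgebras. -/
abbrev ofCommMap (f : S →ₐ[k] S') : Hom (ofComm k S) (ofComm k S') :=
  ofCommHom (A := ofComm k S') f (fun _ => mem_ofComm_zero _)

open TensorProduct

/-- The morphism out of a tensor product of commutative algebras given by a pair of morphisms. -/
noncomputable def ofCommPair {A : CSAlg k} (x : Hom (ofComm k S) A) (y : Hom (ofComm k S') A) :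
    Hom (ofComm k (S ⊗[k] S')) A :=
  ofCommHom (Algebra.TensorProduct.lift x.toAlgHom y.toAlgHom
      (fun s _ => A.commute_of_even (ofComm_hom_even x s) _)) (by
    intro t
    induction t using TensorProduct.induction_on with
    | zero => simp
    | tmul a b =>
      rw [Algebra.TensorProduct.lift_tmul]
      exact SetLike.GradedMul.mul_mem (A := A.grading) (i := 0) (j := 0) (ofComm_hom_even x a)
        (ofComm_hom_even y b)
    | add x y hx hy => rw [map_add]; exact add_mem hx hy)

lemma ofCommPair_tmul {A : CSAlg k} (x : Hom (ofComm k S) A) (y : Hom (ofComm k S') A) (a : S)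
    (b : S') : ofCommPair x y (a ⊗ₜ[k] b : S ⊗[k] S') = x a * y b := rfl

variable (k S S') in
/-- The first inclusion into a tensor product of commutative algebras. -/
noncomputable abbrev ofCommInl : Hom (ofComm k S) (ofComm k (S ⊗[k] S')) :=
  ofCommMap Algebra.TensorProduct.includeLeft

variable (k S S') in
/-- The second inclusion into a tensor product of commutative algebras. -/
noncomputable abbrev ofCommInr : Hom (ofComm k S') (ofComm k (S ⊗[k] S')) :=
  ofCommMap Algebra.TensorProduct.includeRight

lemma ofCommPair_comp_inl {A : CSAlg k} (x : Hom (ofComm k S) A) (y : Hom (ofComm k S') A) :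
    (ofCommPair x y).comp (ofCommInl k S S') = x := by
  ext s
  change ofCommPair x y (s ⊗ₜ[k] (1 : S')) = _
  rw [ofCommPair_tmul]
  have : y (1 : S') = 1 := map_one y
  rw [this, mul_one]

lemma ofCommPair_comp_inr {A : CSAlg k} (x : Hom (ofComm k S) A) (y : Hom (ofComm k S') A) :
    (ofCommPair x y).comp (ofCommInr k S S') = y := by
  ext s
  change ofCommPair x y ((1 : S) ⊗ₜ[k] s) = _
  rw [ofCommPair_tmul]
  have : x (1 : S) = 1 := map_one x
  rw [this, one_mul]

/-- Morphisms from commutative algebras `S`, `S'` to `A`, `B` induce a morphism from `S ⊗ S'` to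
the super tensor product of `A` and `B`. -/
noncomputable def ofCommTensor (h2 : (2 : k) ≠ 0) {A B : CSAlg k} (f : Hom (ofComm k S) A)
    (g : Hom (ofComm k S') B) : Hom (ofComm k (S ⊗[k] S')) (A.tensor B h2) :=
  ofCommPair ((inl h2 A B).comp f) ((inr h2 A B).comp g)

lemma ofCommTensor_comp_inl (h2 : (2 : k) ≠ 0) {A B : CSAlg k} (f : Hom (ofComm k S) A)
    (g : Hom (ofComm k S') B) :
    (ofCommTensor h2 f g).comp (ofCommInl k S S') = (inl h2 A B).comp f :=
  ofCommPair_comp_inl _ _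

lemma ofCommTensor_comp_inr (h2 : (2 : k) ≠ 0) {A B : CSAlg k} (f : Hom (ofComm k S) A)
    (g : Hom (ofComm k S') B) :
    (ofCommTensor h2 f g).comp (ofCommInr k S S') = (inr h2 A B).comp g :=
  ofCommPair_comp_inr _ _

lemma ofCommTensor_eq (h2 : (2 : k) ≠ 0) {A B : CSAlg k} (f : Hom (ofComm k S) A)
    (g : Hom (ofComm k S') B) (t : S ⊗[k] S') :
    ofCommTensor h2 f g t = tensorEquiv h2 A B
      (TensorProduct.map f.toAlgHom.toLinearMap g.toAlgHom.toLinearMap t) := by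
  induction t using TensorProduct.induction_on with
  | zero => rw [map_zero, map_zero]; exact map_zero (ofCommTensor h2 f g)
  | tmul a b =>
    rw [TensorProduct.map_tmul, tensorEquiv_tmul]
    rfl
  | add x y hx hy =>
    rw [map_add, map_add, map_add, hx, hy]

lemma ofComm_tensor_hom_ext {A : CSAlg k} {f g : Hom (ofComm k (S ⊗[k] S')) A}
    (hl : f.comp (ofCommInl k S S') = g.comp (ofCommInl k S S'))
    (hr : f.comp (ofCommInr k S S') = g.comp (ofCommInr k S S')) : f = g := by
  apply GradedAlgHom.coe_toAlgHom_injective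
  apply Algebra.TensorProduct.ext
  · exact congrArg GradedAlgHom.toAlgHom hl
  · exact congrArg GradedAlgHom.toAlgHom hr

lemma comp_ofCommPair {A B : CSAlg k} (φ : Hom A B) (x : Hom (ofComm k S) A)
    (y : Hom (ofComm k S') A) : φ.comp (ofCommPair x y) = ofCommPair (φ.comp x) (φ.comp y) := by
  apply ofComm_tensor_hom_ext
  · rw [GradedAlgHom.comp_assoc, ofCommPair_comp_inl, ofCommPair_comp_inl]
  · rw [GradedAlgHom.comp_assoc, ofCommPair_comp_inr, ofCommPair_comp_inr]

lemma tensorLift_comp_ofCommTensor (h2 : (2 : k) ≠ 0) {A B C : CSAlg k} (f : Hom (ofComm k S) A)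
    (g : Hom (ofComm k S') B) (x : Hom A C) (y : Hom B C) :
    (tensorLift h2 x y).comp (ofCommTensor h2 f g) = ofCommPair (x.comp f) (y.comp g) := by
  rw [ofCommTensor, comp_ofCommPair]
  congr 1 <;> ext s <;> simp

/-- The unique morphism from the base field. -/
noncomputable def ofBase (A : CSAlg k) : Hom (ofComm k k) A :=
  ofCommHom (Algebra.ofId k A) (fun c => by
    change algebraMap k A c ∈ _
    rw [Algebra.algebraMap_eq_smul_one]
    exact Submodule.smul_mem _ _ (SetLike.GradedOne.one_mem (A := A.grading)))

lemma comp_ofBase {A B : CSAlg k} (φ : Hom A B) : φ.comp (ofBase A) = ofBase B := by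
  ext c
  exact φ.commutes c

/-- Everything is flat over a field. This allows identities for a sub-Hopf-algebra to be checked in
tensor powers of `k[G]`. -/
lemma ofCommTensor_injective (h2 : (2 : k) ≠ 0) {A B : CSAlg k} {f : Hom (ofComm k S) A}
    {g : Hom (ofComm k S') B} (hf : Function.Injective f) (hg : Function.Injective g) :
    Function.Injective (ofCommTensor h2 f g) := by
  intro x y h
  have h' : ofCommTensor h2 f g x = ofCommTensor h2 f g y := h
  rw [ofCommTensor_eq, ofCommTensor_eq] at h'
  exact TensorProduct.map_injective_of_flat_flat _ _ hf hg ((tensorEquiv h2 A B).injective h')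

end OfComm

end CSAlg

/-! ### Group schemes attached to sub-Hopf-algebras of the coordinate superalgebra. -/

namespace AffineSupergroup

open CSAlg TensorProduct

variable {k : Type u} [Field k]

/-- The restriction of a point of `G` along a morphism into `k[G]`. -/
def restr {G : AffineSupergroup k} {C A : CSAlg k} (j : CSAlg.Hom C G.coord) (g : G.Points A) :
    CSAlg.Hom C A :=
  GradedAlgHom.comp (show CSAlg.Hom G.coord A from g) j

/-- The universal point of `G`. -/
def univ (G : AffineSupergroup k) : G.Points G.coord := GradedAlgHom.id k G.coord.grading

lemma map_univ (G : AffineSupergroup k) {A : CSAlg k} (g : G.Points A) :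
    G.map (show CSAlg.Hom G.coord A from g) G.univ = g := rfl

lemma comp_restr {G : AffineSupergroup k} {C A B : CSAlg k} (φ : CSAlg.Hom A B)
    (j : CSAlg.Hom C G.coord) (g : G.Points A) :
    GradedAlgHom.comp φ (restr j g) = restr j (G.map φ g) := rfl

lemma map_map (G : AffineSupergroup k) {A B C : CSAlg k} (φ : CSAlg.Hom A B) (ψ : CSAlg.Hom B C)
    (g : G.Points A) : G.map ψ (G.map φ g) = G.map (GradedAlgHom.comp ψ φ) g := rfl

lemma points_ext {G : AffineSupergroup k} {A : CSAlg k} {g h : G.Points A}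
    (H : ∀ a, (show CSAlg.Hom G.coord A from g) a = (show CSAlg.Hom G.coord A from h) a) :
    g = h :=
  GradedAlgHom.ext H

section Universal

variable (h2 : (2 : k) ≠ 0) (G : AffineSupergroup k)

/-- The first universal point over `k[G] ⊗ k[G]`. -/
noncomputable def fst : G.Points (G.coord.tensor G.coord h2) := inl h2 G.coord G.coord

/-- The second universal point over `k[G] ⊗ k[G]`. -/
noncomputable def snd : G.Points (G.coord.tensor G.coord h2) := inr h2 G.coord G.coord

/-- The morphism from `k[G] ⊗ k[G]` classifying a pair of points. -/
noncomputable def pair {A : CSAlg k} (g h : G.Points A) :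
    CSAlg.Hom (G.coord.tensor G.coord h2) A :=
  tensorLift h2 (show CSAlg.Hom G.coord A from g) (show CSAlg.Hom G.coord A from h)

lemma map_pair_fst {A : CSAlg k} (g h : G.Points A) : G.map (G.pair h2 g h) (G.fst h2) = g :=
  points_ext (tensorLift_inl h2 _ _)

lemma map_pair_snd {A : CSAlg k} (g h : G.Points A) : G.map (G.pair h2 g h) (G.snd h2) = h :=
  points_ext (tensorLift_inr h2 _ _)

end Universal

variable {S : Type u} [CommRing S] [Algebra k S]

/-- The subalgebra given by `j : S → k[G]` is a sub-Hopf-algebra. -/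
structure IsHopfSub (h2 : (2 : k) ≠ 0) (G : AffineSupergroup k)
    (j : CSAlg.Hom (ofComm k S) G.coord) : Prop where
  injective : Function.Injective j
  -- The product of the two universal points is the comultiplication of `k[G]`, and the inverse of
  -- the universal point is its antipode. The counit restricts to `S` without any condition.
  comul : ∀ s, ∃ t, ofCommTensor h2 j j t = restr j (G.fst h2 * G.snd h2) s
  antipode : ∀ s, ∃ t, j t = restr j G.univ⁻¹ s

namespace IsHopfSub

variable {h2 : (2 : k) ≠ 0} {G : AffineSupergroup k} {j : CSAlg.Hom (ofComm k S) G.coord}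
  (hj : IsHopfSub h2 G j)

include hj

lemma exists_comul : ∃ δ : CSAlg.Hom (ofComm k S) (ofComm k (S ⊗[k] S)),
    (ofCommTensor h2 j j).comp δ = restr j (G.fst h2 * G.snd h2) :=
  exists_comp_eq h2 (ofCommTensor_injective h2 hj.injective hj.injective) hj.comul

lemma exists_antipode : ∃ σ : CSAlg.Hom (ofComm k S) (ofComm k S), j.comp σ = restr j G.univ⁻¹ :=
  exists_comp_eq h2 hj.injective hj.antipode

/-- The multiplication of points. -/
noncomputable def mul {A : CSAlg k} (x y : CSAlg.Hom (ofComm k S) A) :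
    CSAlg.Hom (ofComm k S) A :=
  (ofCommPair x y).comp hj.exists_comul.choose

/-- The inverse of points. -/
noncomputable def inv {A : CSAlg k} (x : CSAlg.Hom (ofComm k S) A) : CSAlg.Hom (ofComm k S) A :=
  x.comp hj.exists_antipode.choose

omit hj in
variable (j) in
/-- The neutral point. -/
noncomputable def one (A : CSAlg k) : CSAlg.Hom (ofComm k S) A :=
  (ofBase A).comp (restr j (1 : G.Points (ofComm k k)))

lemma comp_mul {A B : CSAlg k} (φ : CSAlg.Hom A B) (x y : CSAlg.Hom (ofComm k S) A) :
    φ.comp (hj.mul x y) = hj.mul (φ.comp x) (φ.comp y) := by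
  rw [mul, mul, ← comp_ofCommPair, GradedAlgHom.comp_assoc]

lemma comp_inv {A B : CSAlg k} (φ : CSAlg.Hom A B) (x : CSAlg.Hom (ofComm k S) A) :
    φ.comp (hj.inv x) = hj.inv (φ.comp x) := rfl

omit hj in
lemma comp_one {A B : CSAlg k} (φ : CSAlg.Hom A B) : φ.comp (one j A) = one j B := by
  rw [one, ← GradedAlgHom.comp_assoc, comp_ofBase]
  rfl

/-- Every pair of points is the image of the universal pair over `k[G] ⊗ k[G]`, where the claim is
the choice of the comultiplication on `S`. -/
lemma restr_mul {A : CSAlg k} (g h : G.Points A) :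
    restr j (g * h) = hj.mul (restr j g) (restr j h) := by
  rw [mul]
  have h1 := tensorLift_comp_ofCommTensor h2 j j (show CSAlg.Hom G.coord A from g)
    (show CSAlg.Hom G.coord A from h)
  change _ = ofCommPair (restr j g) (restr j h) at h1
  rw [← h1, GradedAlgHom.comp_assoc, hj.exists_comul.choose_spec]
  change _ = restr j (G.map (G.pair h2 g h) (G.fst h2 * G.snd h2))
  rw [map_mul, map_pair_fst, map_pair_snd]

lemma restr_inv {A : CSAlg k} (g : G.Points A) : restr j g⁻¹ = hj.inv (restr j g) := by
  have : hj.inv (restr j g) = GradedAlgHom.comp (show CSAlg.Hom G.coord A from g)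
    (j.comp hj.exists_antipode.choose) := rfl
  rw [this, hj.exists_antipode.choose_spec, comp_restr, map_inv, map_univ]

omit hj in
lemma restr_one (A : CSAlg k) : restr j (1 : G.Points A) = one j A := by
  rw [one, comp_restr, map_one]

/-- Points of `Spec S` need not lift to `G`. The universal triple over `S ⊗ S ⊗ S` does lift after
the injection into `k[G] ⊗ k[G] ⊗ k[G]`, and there associativity in `G` applies. -/
lemma mul_assoc {A : CSAlg k} (x y z : CSAlg.Hom (ofComm k S) A) :
    hj.mul (hj.mul x y) z = hj.mul x (hj.mul y z) := by
  let U := (S ⊗[k] S) ⊗[k] S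
  let x₀ : CSAlg.Hom (ofComm k S) (ofComm k U) :=
    (ofCommInl k (S ⊗[k] S) S).comp (ofCommInl k S S)
  let y₀ : CSAlg.Hom (ofComm k S) (ofComm k U) :=
    (ofCommInl k (S ⊗[k] S) S).comp (ofCommInr k S S)
  let z₀ : CSAlg.Hom (ofComm k S) (ofComm k U) := ofCommInr k (S ⊗[k] S) S
  let w : CSAlg.Hom (ofComm k U) A := ofCommPair (ofCommPair x y) z
  have hx : w.comp x₀ = x := by
    rw [← GradedAlgHom.comp_assoc, ofCommPair_comp_inl, ofCommPair_comp_inl]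
  have hy : w.comp y₀ = y := by
    rw [← GradedAlgHom.comp_assoc, ofCommPair_comp_inl, ofCommPair_comp_inr]
  have hz : w.comp z₀ = z := ofCommPair_comp_inr _ _
  rw [← hx, ← hy, ← hz]
  rw [← hj.comp_mul w x₀ y₀, ← hj.comp_mul w y₀ z₀, ← hj.comp_mul w, ← hj.comp_mul w]
  congr 1
  let Ψ := ofCommTensor h2 (ofCommTensor h2 j j) j
  have hΨ : Function.Injective Ψ := ofCommTensor_injective h2
    (ofCommTensor_injective h2 hj.injective hj.injective) hj.injective
  let L := inl h2 (G.coord.tensor G.coord h2) G.coord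
  have hx' : Ψ.comp x₀ = restr j (G.map L (G.fst h2)) := by
    rw [← GradedAlgHom.comp_assoc, ofCommTensor_comp_inl, GradedAlgHom.comp_assoc,
      ofCommTensor_comp_inl]
    rfl
  have hy' : Ψ.comp y₀ = restr j (G.map L (G.snd h2)) := by
    rw [← GradedAlgHom.comp_assoc, ofCommTensor_comp_inl, GradedAlgHom.comp_assoc,
      ofCommTensor_comp_inr]
    rfl
  have hz' : Ψ.comp z₀ =
      restr j (G.map (inr h2 (G.coord.tensor G.coord h2) G.coord) G.univ) := by
    rw [ofCommTensor_comp_inr]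
    rfl
  apply Hom.cancel_inj hΨ
  rw [hj.comp_mul Ψ (hj.mul x₀ y₀) z₀, hj.comp_mul Ψ x₀ y₀, hj.comp_mul Ψ x₀ (hj.mul y₀ z₀),
    hj.comp_mul Ψ y₀ z₀, hx', hy', hz', ← hj.restr_mul, ← hj.restr_mul, ← hj.restr_mul,
    ← hj.restr_mul, _root_.mul_assoc]

omit hj in
lemma eq_comp_id {A : CSAlg k} (x : CSAlg.Hom (ofComm k S) A) :
    x = x.comp (GradedAlgHom.id k (ofComm k S).grading) := rfl

omit hj in
lemma comp_id_eq_restr : j.comp (GradedAlgHom.id k (ofComm k S).grading) = restr j G.univ := rfl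

/-- For the axioms in one variable the universal case is the identity of `S`, which the injection
`j` turns into the restriction of the universal point of `G`. -/
lemma one_mul {A : CSAlg k} (x : CSAlg.Hom (ofComm k S) A) : hj.mul (one j A) x = x := by
  rw [eq_comp_id x, ← comp_one x, ← comp_mul]
  congr 1
  apply Hom.cancel_inj hj.injective
  rw [comp_mul, comp_one, comp_id_eq_restr, ← restr_one, ← restr_mul, _root_.one_mul]

lemma mul_one {A : CSAlg k} (x : CSAlg.Hom (ofComm k S) A) : hj.mul x (one j A) = x := by
  rw [eq_comp_id x, ← comp_one x, ← comp_mul]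
  congr 1
  apply Hom.cancel_inj hj.injective
  rw [comp_mul, comp_one, comp_id_eq_restr, ← restr_one, ← restr_mul, _root_.mul_one]

lemma inv_mul_cancel {A : CSAlg k} (x : CSAlg.Hom (ofComm k S) A) :
    hj.mul (hj.inv x) x = one j A := by
  rw [eq_comp_id x, ← comp_one x, ← comp_inv, ← comp_mul]
  congr 1
  apply Hom.cancel_inj hj.injective
  rw [comp_mul, comp_one, comp_inv, comp_id_eq_restr, ← restr_one, ← restr_inv, ← restr_mul,
    _root_.inv_mul_cancel]

/-- The affine group scheme with coordinate algebra a sub-Hopf-algebra of `k[G]`. -/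
noncomputable def spec : AffineSupergroup k where
  coord := ofComm k S
  group A :=
    { mul := hj.mul
      one := one j A
      inv := hj.inv
      mul_assoc := hj.mul_assoc
      one_mul := hj.one_mul
      mul_one := hj.mul_one
      inv_mul_cancel := hj.inv_mul_cancel }
  comp_mul φ g h := hj.comp_mul φ g h

/-- The homomorphism from `G` to the group scheme of a sub-Hopf-algebra of `k[G]`. -/
noncomputable def hom : Hom G hj.spec where
  comorph := j
  mul_comp _ g h := hj.restr_mul g h

end IsHopfSub

lemma Hom.ext_comorph {G G' : AffineSupergroup k} {f g : Hom G G'} (h : f.comorph = g.comorph) :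
    f = g := by
  cases f; cases g; cases h; rfl

/-- Sub-Hopf-algebras `S' ⊆ S` of `k[G]` give a homomorphism between their group schemes, as does
every homomorphism from `G` whose comorphism factors through `S`. -/
noncomputable def IsHopfSub.factor {h2 : (2 : k) ≠ 0} {G : AffineSupergroup k}
    {j : CSAlg.Hom (ofComm k S) G.coord} (hj : IsHopfSub h2 G j) {E : AffineSupergroup k}
    (f : Hom G E) (φ : CSAlg.Hom E.coord (ofComm k S)) (hφ : j.comp φ = f.comorph) :
    Hom hj.spec E where
  comorph := φ
  mul_comp := by
    intro A x y
    let x₀ : hj.spec.Points (ofComm k (S ⊗[k] S)) := ofCommInl k S S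
    let y₀ : hj.spec.Points (ofComm k (S ⊗[k] S)) := ofCommInr k S S
    let w : CSAlg.Hom (ofComm k (S ⊗[k] S)) A :=
      ofCommPair (show CSAlg.Hom (ofComm k S) A from x) (show CSAlg.Hom (ofComm k S) A from y)
    have hx : hj.spec.map w x₀ = x := ofCommPair_comp_inl _ _
    have hy : hj.spec.map w y₀ = y := ofCommPair_comp_inr _ _
    have nat : ∀ {A B : CSAlg k} (ψ : CSAlg.Hom A B) (z : hj.spec.Points A),
      pullback (G' := E) φ (hj.spec.map ψ z) = E.map ψ (pullback (G' := E) φ z) := fun _ _ => rfl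
    rw [← hx, ← hy, ← map_mul, nat, nat, nat, ← map_mul]
    congr 1
    have hΨ := ofCommTensor_injective h2 hj.injective hj.injective
    have hx' : hj.spec.map (ofCommTensor h2 j j) x₀ = hj.hom.app _ (G.fst h2) :=
      ofCommPair_comp_inl _ _
    have hy' : hj.spec.map (ofCommTensor h2 j j) y₀ = hj.hom.app _ (G.snd h2) :=
      ofCommPair_comp_inr _ _
    have comp : ∀ {A : CSAlg k} (z : G.Points A),
        pullback (G' := E) φ (hj.hom.app A z) = f.app A z := fun z =>
      congrArg (GradedAlgHom.comp (show CSAlg.Hom G.coord _ from z)) hφ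
    -- Over `k[G] ⊗ k[G]` the universal points of `Spec S` come from points of `G`, on which `f` is
    -- multiplicative.
    have key : E.map (ofCommTensor h2 j j) (pullback (G' := E) φ (x₀ * y₀)) =
        E.map (ofCommTensor h2 j j)
          (pullback (G' := E) φ x₀ * pullback (G' := E) φ y₀) := by
      rw [map_mul, ← nat, ← nat, ← nat, map_mul, hx', hy', ← map_mul, comp, comp, comp, map_mul]
    exact Hom.cancel_inj hΨ key

end AffineSupergroup

/-! ### Kernels of homomorphisms to purely even supergroup schemes. -/

namespace AffineSupergroup

open CSAlg TensorProduct

variable {k : Type u} [Field k]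

lemma one_apply (G : AffineSupergroup k) {A : CSAlg k} (a : G.coord) :
    (show CSAlg.Hom G.coord A from (1 : G.Points A)) a = ofBase A (G.counit a) := by
  have : G.map (ofBase A) (1 : G.Points (ofComm k k)) = 1 := map_one _
  rw [← this]
  rfl

lemma counit_sub (G : AffineSupergroup k) (a : G.coord) :
    G.counit (a - algebraMap k G.coord (G.counit a)) = 0 := by
  rw [map_sub, GradedAlgHom.commutes]
  exact sub_self _

/-- The image in `k[G]` of the augmentation ideal of `k[Q]`, for a homomorphism `G → Q`. -/
def kerGenerators {G Q : AffineSupergroup k} (f : Hom G Q) : Set G.coord :=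
  f.comorph '' {a | Q.counit a = 0}

lemma kerGenerators_even {G Q : AffineSupergroup k} (f : Hom G Q) (hQ : Q.IsPurelyEven) :
    kerGenerators f ⊆ G.coord.grading 0 := by
  rintro _ ⟨a, -, rfl⟩
  exact f.comorph.map_mem_grading (hQ.symm ▸ Submodule.mem_top)

lemma app_eq_one_iff {G Q : AffineSupergroup k} (f : Hom G Q) {A : CSAlg k} (g : G.Points A) :
    f.app A g = 1 ↔ ∀ a ∈ kerGenerators f, (show CSAlg.Hom G.coord A from g) a = 0 := by
  constructor
  · rintro h _ ⟨a, ha, rfl⟩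
    have h1 : (show CSAlg.Hom G.coord A from g) (f.comorph a) =
      (show CSAlg.Hom Q.coord A from f.app A g) a := rfl
    rw [h1, h, one_apply]
    exact (congrArg _ ha).trans (map_zero (ofBase A))
  · intro h
    refine points_ext fun a => ?_
    rw [one_apply]
    -- Every function differs from its counit by an element of the augmentation ideal.
    have h1 := h _ ⟨_, Q.counit_sub a, rfl⟩
    rw [map_sub, map_sub, sub_eq_zero, GradedAlgHom.commutes, GradedAlgHom.commutes] at h1
    exact h1

section Kernel

variable (h2 : (2 : k) ≠ 0) {G Q : AffineSupergroup k} (f : Hom G Q) (hQ : Q.IsPurelyEven)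

/-- The coordinate superalgebra of the kernel of a homomorphism. -/
noncomputable abbrev kernelCoord : CSAlg k :=
  G.coord.quot h2 (kerGenerators f) (kerGenerators_even f hQ)

/-- Points of the kernel are the points of `G` in the kernel. -/
noncomputable def kernelEquiv (A : CSAlg k) :
    CSAlg.Hom (kernelCoord h2 f hQ) A ≃ (f.app A).ker where
  toFun x := ⟨(x.comp (G.coord.quotMk h2 _ (kerGenerators_even f hQ)) : CSAlg.Hom G.coord A), by
    refine (app_eq_one_iff f _).2 fun a ha => ?_
    change x (G.coord.quotMk h2 _ (kerGenerators_even f hQ) a) = 0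
    rw [(G.coord.quotMk_eq_zero_iff h2 _ _).2 (Ideal.subset_span ha), map_zero]⟩
  invFun g := G.coord.quotLift h2 _ (kerGenerators_even f hQ) (show CSAlg.Hom G.coord A from g.1)
    ((app_eq_one_iff f g.1).1 g.2)
  left_inv x := by
    ext a
    obtain ⟨a, rfl⟩ := G.coord.quotMk_surjective h2 _ (kerGenerators_even f hQ) a
    rfl
  right_inv g := rfl

/-- The kernel of a homomorphism to a purely even supergroup scheme. -/
noncomputable def kernel : AffineSupergroup k where
  coord := kernelCoord h2 f hQ
  group A := (kernelEquiv h2 f hQ A).group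
  comp_mul {A B} φ g h := by
    let _ := fun A => (kernelEquiv h2 f hQ A).group
    have hm : ∀ {A : CSAlg k} (x y : CSAlg.Hom (kernelCoord h2 f hQ) A),
        ((kernelEquiv h2 f hQ A (x * y) : (f.app A).ker) : G.Points A) =
          kernelEquiv h2 f hQ A x * kernelEquiv h2 f hQ A y := by
      intro A x y
      rw [Equiv.mul_def, Equiv.apply_symm_apply]
      rfl
    have hn : ∀ x : CSAlg.Hom (kernelCoord h2 f hQ) A,
        (kernelEquiv h2 f hQ B (φ.comp x) : G.Points B) =
          G.map φ (kernelEquiv h2 f hQ A x : G.Points A) := fun _ => rfl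
    apply (kernelEquiv h2 f hQ B).injective
    apply Subtype.ext
    rw [hm, hn, hn, hn, hm, map_mul]

/-- The inclusion of the kernel. -/
noncomputable def kernelInclusion : Hom (kernel h2 f hQ) G where
  comorph := G.coord.quotMk h2 _ (kerGenerators_even f hQ)
  mul_comp A x y := by
    let _ := (kernelEquiv h2 f hQ A).group
    have : ((kernelEquiv h2 f hQ A (x * y) : (f.app A).ker) : G.Points A) =
        kernelEquiv h2 f hQ A x * kernelEquiv h2 f hQ A y :=
      congrArg Subtype.val ((kernelEquiv h2 f hQ A).apply_symm_apply _)
    exact this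

lemma kernelInclusion_isClosedEmbedding : (kernelInclusion h2 f hQ).IsClosedEmbedding :=
  G.coord.quotMk_surjective h2 _ _

lemma range_kernelInclusion (A : CSAlg k) :
    ((kernelInclusion h2 f hQ).app A).range = (f.app A).ker := by
  ext g
  constructor
  · rintro ⟨x, rfl⟩
    exact (kernelEquiv h2 f hQ A x).2
  · intro hg
    exact ⟨(kernelEquiv h2 f hQ A).symm ⟨g, hg⟩,
      congrArg Subtype.val ((kernelEquiv h2 f hQ A).apply_symm_apply ⟨g, hg⟩)⟩

lemma kernelInclusion_injective (A : CSAlg k) :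
    Function.Injective ((kernelInclusion h2 f hQ).app A) := fun _ _ h =>
  (kernelEquiv h2 f hQ A).injective (Subtype.ext h)

lemma kernelInclusion_isNormal : (kernelInclusion h2 f hQ).IsNormal := fun A => by
  rw [range_kernelInclusion]
  infer_instance

end Kernel

/-! ### Split extensions and semidirect products. -/

section Semidirect

/-- The action of `Q` on `N` by conjugation through a section of `G → Q`. -/
noncomputable def sectionAction {N G Q : Type*} [Group N] [Group G] [Group Q] (ι : N →* G)
    (hι : Function.Injective ι) (hn : ι.range.Normal) (s : Q →* G) : Q →* MulAut N :=
  (MulAut.congr (MonoidHom.ofInjective hι).symm).toMonoidHom.comp (MulAut.conjNormal.comp s)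

lemma apply_sectionAction {N G Q : Type*} [Group N] [Group G] [Group Q] (ι : N →* G)
    (hι : Function.Injective ι) (hn : ι.range.Normal) (s : Q →* G) (x : Q) (n : N) :
    ι (sectionAction ι hι hn s x n) = s x * ι n * (s x)⁻¹ :=
  congrArg Subtype.val ((MonoidHom.ofInjective hι).apply_symm_apply
    (MulAut.conjNormal (s x) (MonoidHom.ofInjective hι n)))

lemma lift_bijective {N G Q : Type*} [Group N] [Group G] [Group Q] (ι : N →* G)
    (hι : Function.Injective ι) (π : G →* Q) (hr : ι.range = π.ker) (s : Q →* G)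
    (hs : ∀ x, π (s x) = x) {α : Q →* MulAut N}
    (hα : ∀ x, ι.comp (α x).toMonoidHom = (MulAut.conj (s x)).toMonoidHom.comp ι) :
    Function.Bijective (SemidirectProduct.lift ι s hα) := by
  have hπ : ∀ n, π (ι n) = 1 := fun n => by
    have : ι n ∈ π.ker := hr ▸ ⟨n, rfl⟩
    exact this
  constructor
  · rw [injective_iff_map_eq_one]
    rintro ⟨n, x⟩ h
    have h : ι n * s x = 1 := h
    have hx : x = 1 := by
      have := congrArg π h
      rwa [map_mul, hπ, hs, one_mul, map_one] at this
    subst hx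
    rw [map_one, mul_one] at h
    rw [(injective_iff_map_eq_one ι).1 hι n h]
    rfl
  · intro g
    have : g * (s (π g))⁻¹ ∈ ι.range := by
      rw [hr, MonoidHom.mem_ker, map_mul, map_inv, hs, mul_inv_cancel]
    obtain ⟨n, hn⟩ := this
    refine ⟨⟨n, π g⟩, ?_⟩
    change ι n * s (π g) = g
    rw [hn, inv_mul_cancel_right]

/-- A quotient homomorphism with a functorial section gives a semidirect product. -/
lemma isSemidirectProduct_of_section {N G Q : AffineSupergroup k} (ι : Hom N G) (π : Hom G Q)
    (hι : ∀ A, Function.Injective (ι.app A)) (hr : ∀ A, (ι.app A).range = (π.app A).ker)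
    (s : Hom Q G) (hs : ∀ (A : CSAlg k) (x : Q.Points A), π.app A (s.app A x) = x) :
    IsSemidirectProduct ι π := by
  have hn : ∀ A, (ι.app A).range.Normal := fun A => by rw [hr]; infer_instance
  have nι : ∀ {A B : CSAlg k} (φ : CSAlg.Hom A B) (n : N.Points A),
    ι.app B (N.map φ n) = G.map φ (ι.app A n) := fun _ _ => rfl
  have ns : ∀ {A B : CSAlg k} (φ : CSAlg.Hom A B) (x : Q.Points A),
    s.app B (Q.map φ x) = G.map φ (s.app A x) := fun _ _ => rfl
  let α : ∀ A, Q.Points A →* MulAut (N.Points A) := fun A =>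
    sectionAction (ι.app A) (hι A) (hn A) (s.app A)
  have hα' : ∀ A (x : Q.Points A) (n : N.Points A),
      ι.app A (α A x n) = s.app A x * ι.app A n * (s.app A x)⁻¹ := fun A x n =>
    apply_sectionAction _ _ _ _ _ _
  have hα : ∀ A (x : Q.Points A), (ι.app A).comp (α A x).toMonoidHom =
      (MulAut.conj (s.app A x)).toMonoidHom.comp (ι.app A) := fun A x =>
    MonoidHom.ext (hα' A x)
  let e : ∀ A, N.Points A ⋊[α A] Q.Points A ≃* G.Points A := fun A =>
    MulEquiv.ofBijective _ (lift_bijective (ι.app A) (hι A) (π.app A) (hr A) (s.app A) (hs A)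
      (hα A))
  have he : ∀ A z, e A z = ι.app A z.left * s.app A z.right := fun A z => rfl
  refine ⟨α, fun A => (e A).symm, ?_, ?_, ?_, ?_⟩
  · intro A B φ x n
    apply hι B
    rw [nι, hα', hα', map_mul, map_mul, map_inv, nι, ns]
  · intro A B φ g
    obtain ⟨z, rfl⟩ := (e A).surjective g
    rw [MulEquiv.symm_apply_apply, MulEquiv.symm_apply_eq, he, he, map_mul, nι, ns]
  · intro A n
    rw [MulEquiv.symm_apply_eq, he]
    simp
  · intro A g
    obtain ⟨z, rfl⟩ := (e A).surjective g
    rw [MulEquiv.symm_apply_apply, he, map_mul, hs]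
    have : ι.app A z.left ∈ (π.app A).ker := hr A ▸ ⟨_, rfl⟩
    rw [MonoidHom.mem_ker.1 this, one_mul]

end Semidirect

end AffineSupergroup

/-! ### Tensor squares of intersections of subspaces. -/

section TensorIntersection

open TensorProduct

variable {k V : Type*} [Field k] [AddCommGroup V] [Module k V]

lemma TensorProduct.rid_lTensor_mem {W W' : Submodule k V} (φ : V →ₗ[k] k) {t : V ⊗[k] V}
    (ht : t ∈ Submodule.map₂ (TensorProduct.mk k V V) W W') :
    TensorProduct.rid k V (φ.lTensor V t) ∈ W := by
  change t ∈ W.comap ((TensorProduct.rid k V).toLinearMap ∘ₗ φ.lTensor V)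
  refine Submodule.map₂_le.2 (fun a ha b _ => ?_) ht
  simpa using W.smul_mem _ ha

lemma TensorProduct.lid_rTensor_mem {W W' : Submodule k V} (φ : V →ₗ[k] k) {t : V ⊗[k] V}
    (ht : t ∈ Submodule.map₂ (TensorProduct.mk k V V) W W') :
    TensorProduct.lid k V (φ.rTensor V t) ∈ W' := by
  change t ∈ W'.comap ((TensorProduct.lid k V).toLinearMap ∘ₗ φ.rTensor V)
  refine Submodule.map₂_le.2 (fun a _ b hb => ?_) ht
  simpa using W'.smul_mem _ hb

/-- Over a field, the intersection of the subspaces `Wᵢ ⊗ Wᵢ` is contained in `(⨅ Wᵢ) ⊗ (⨅ Wᵢ)`. -/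
lemma TensorProduct.mem_map₂_mk_iInf {ι : Sort*} (W : ι → Submodule k V) {t : V ⊗[k] V}
    (ht : ∀ i, t ∈ Submodule.map₂ (TensorProduct.mk k V V) (W i) (W i)) :
    t ∈ Submodule.map₂ (TensorProduct.mk k V V) (⨅ i, W i) (⨅ i, W i) := by
  classical
  set D := ⨅ i, W i with hD
  -- The coordinates of `t` along a basis of the right factor are slices of `t` by functionals, so
  -- they lie in every `W i`.
  obtain ⟨t', rfl⟩ : ∃ t' : D ⊗[k] V, D.subtype.rTensor V t' = t := by
    let b := Module.Basis.ofVectorSpace k V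
    have hc : ∀ i, TensorProduct.equivFinsuppOfBasisRight b t i ∈ D := fun i => by
      rw [TensorProduct.equivFinsuppOfBasisRight_apply, hD, Submodule.mem_iInf]
      exact fun n => TensorProduct.rid_lTensor_mem _ (ht n)
    refine ⟨∑ i ∈ (TensorProduct.equivFinsuppOfBasisRight b t).support, ⟨_, hc i⟩ ⊗ₜ b i, ?_⟩
    rw [map_sum]
    conv_rhs => rw [← (TensorProduct.equivFinsuppOfBasisRight b).symm_apply_apply t,
      TensorProduct.equivFinsuppOfBasisRight_symm_apply]
    rfl
  let d := Module.Basis.ofVectorSpace k D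
  have hc : ∀ i, TensorProduct.equivFinsuppOfBasisLeft d t' i ∈ D := fun i => by
    rw [TensorProduct.equivFinsuppOfBasisLeft_apply]
    refine (Submodule.mem_iInf _).2 fun n => ?_
    -- The coordinate functional lives on `D` only; it must be extended to `V` before it can slice a
    -- tensor in `W n ⊗ W n`.
    obtain ⟨f, hf⟩ := LinearMap.exists_extend (d.coord i)
    have := TensorProduct.lid_rTensor_mem f (ht n)
    rwa [← LinearMap.comp_apply, ← LinearMap.rTensor_comp, hf] at this
  rw [← (TensorProduct.equivFinsuppOfBasisLeft d).symm_apply_apply t',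
    TensorProduct.equivFinsuppOfBasisLeft_symm_apply, Finsupp.sum, map_sum]
  exact sum_mem fun i _ => Submodule.apply_mem_map₂ (TensorProduct.mk k V V) (d i).2 (hc i)

end TensorIntersection

/-! ### Subalgebras of `p ^ n`-th powers in commutative algebras, and their intersection. -/

section PerfectCore

variable (k : Type*) [Field k] [PerfectField k] (p : ℕ) [Fact p.Prime] [CharP k p]
variable (C : Type*) [CommRing C] [Algebra k C] [CharP C p]

/-- The subalgebra of `p ^ n`-th powers in an algebra over a perfect field. -/
def Subalgebra.powers (n : ℕ) : Subalgebra k C where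
  toSubsemiring := (iterateFrobenius C p n).rangeS
  algebraMap_mem' c := ⟨algebraMap k C ((iterateFrobeniusEquiv k p n).symm c), by
    rw [iterateFrobenius_def, ← map_pow, ← iterateFrobeniusEquiv_def, RingEquiv.apply_symm_apply]⟩

/-- The largest perfect subalgebra up to nilpotents: the intersection of the subalgebras of
`p ^ n`-th powers. -/
def Subalgebra.perfectCore : Subalgebra k C := ⨅ n, Subalgebra.powers k p C n

variable {k p C}

lemma Subalgebra.mem_powers {n : ℕ} {x : C} :
    x ∈ Subalgebra.powers k p C n ↔ ∃ y, y ^ p ^ n = x := Iff.rfl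

lemma Subalgebra.mem_perfectCore {x : C} :
    x ∈ Subalgebra.perfectCore k p C ↔ ∀ n, ∃ y, y ^ p ^ n = x := by
  simp [Subalgebra.perfectCore, Subalgebra.mem_powers]

lemma Subalgebra.powers_antitone : Antitone (Subalgebra.powers k p C) := by
  intro m n h x
  rw [mem_powers, mem_powers]
  rintro ⟨y, rfl⟩
  exact ⟨y ^ p ^ (n - m), by rw [← pow_mul, ← pow_add, Nat.sub_add_cancel h]⟩

lemma Subalgebra.exists_powers_eq_perfectCore [Module.Finite k C] :
    ∃ n, ∀ m, n ≤ m → Subalgebra.powers k p C m = Subalgebra.perfectCore k p C := by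
  obtain ⟨n, hn⟩ := IsArtinian.monotone_stabilizes (R := k) (M := C)
    ⟨fun n => OrderDual.toDual (Subalgebra.toSubmodule (Subalgebra.powers k p C n)),
      fun _ _ h => Subalgebra.toSubmodule.monotone (Subalgebra.powers_antitone h)⟩
  have hn' : ∀ m, n ≤ m → Subalgebra.powers k p C n = Subalgebra.powers k p C m := fun m hm =>
    Subalgebra.toSubmodule_injective (hn m hm)
  have : Subalgebra.powers k p C n = Subalgebra.perfectCore k p C := by
    refine le_antisymm (le_iInf fun m => ?_) (iInf_le _ _)
    rcases le_total n m with h | h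
    · rw [hn' m h]
    · exact Subalgebra.powers_antitone h
  exact ⟨n, fun m hm => (hn' m hm).symm.trans this⟩

/-- A finite reduced algebra over a perfect field of characteristic `p` is perfect. -/
lemma exists_pow_eq_of_finite_reduced (k : Type*) [Field k] [PerfectField k] {p : ℕ}
    [Fact p.Prime] [CharP k p] {C : Type*} [CommRing C] [Algebra k C] [CharP C p]
    [Module.Finite k C] [IsReduced C] (x : C) : ∃ y, y ^ p = x := by
  obtain ⟨n, hn⟩ := Subalgebra.exists_powers_eq_perfectCore (k := k) (p := p) (C := C)
  -- The chain of powers is stationary at `n`, so `x ^ p ^ n = y ^ p ^ (n + 1)`; reducedness then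
  -- permits cancelling the exponent `p ^ n`.
  have h1 : x ^ p ^ n ∈ Subalgebra.powers k p C (n + 1) := by
    rw [hn _ n.le_succ, ← hn n le_rfl]
    exact ⟨x, rfl⟩
  obtain ⟨y, hy⟩ := h1
  refine ⟨y, ?_⟩
  have h2 : (y ^ p - x) ^ p ^ n = 0 := by
    rw [sub_pow_char_pow, ← pow_mul, ← pow_succ', sub_eq_zero]
    exact hy
  exact sub_eq_zero.1 (eq_zero_of_pow_eq_zero h2)

/-- For each `i`, `x` is a `p ^ i`-th power of an element that lies in `I` by radicality. So `x`
lies in all powers of `I`, and Krull's intersection theorem applies. -/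
lemma Subalgebra.exists_mul_eq_of_mem_perfectCore [IsNoetherianRing C] {I : Ideal C}
    (hI : I.IsRadical) {x : C} (hx : x ∈ Subalgebra.perfectCore k p C) (hxI : x ∈ I) :
    ∃ r ∈ I, r * x = x := by
  have : x ∈ (⨅ i : ℕ, I ^ i • ⊤ : Submodule C C) := by
    rw [Submodule.mem_iInf]
    intro i
    obtain ⟨y, rfl⟩ := Subalgebra.mem_perfectCore.1 hx i
    have hy : y ∈ I := hI ⟨_, hxI⟩
    rw [smul_eq_mul, Ideal.mul_top]
    exact Ideal.pow_le_pow_right (Nat.lt_pow_self (Fact.out : p.Prime).one_lt).le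
      (Ideal.pow_mem_pow hy _)
  obtain ⟨r, hr⟩ := (I.mem_iInf_smul_pow_eq_bot_iff x).1 this
  exact ⟨r, r.2, hr⟩

/-- Taking the nilradical for `I` gives `x = r * x` with `r` nilpotent, and `1 - r` is a unit. -/
lemma Subalgebra.isReduced_perfectCore [IsNoetherianRing C] :
    IsReduced (Subalgebra.perfectCore k p C) := by
  refine ⟨fun x hx => ?_⟩
  have hx' : (x : C) ∈ nilradical C := hx.map (Subalgebra.perfectCore k p C).val
  obtain ⟨r, hr, h⟩ := Subalgebra.exists_mul_eq_of_mem_perfectCore (Ideal.radical_isRadical ⊥)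
    x.2 hx'
  have hu : IsUnit (1 - r) := IsNilpotent.isUnit_one_sub hr
  have h0 : (1 - r) * (x : C) = 0 := by rw [sub_mul, one_mul, h, sub_self]
  exact Subtype.ext ((hu.mul_right_eq_zero).1 h0)

/-- Choose a maximal ideal above each of the finitely many minimal primes; the residue fields are
finite over `k` by the Nullstellensatz, and the core embeds in their product. Indeed, if `x`
vanishes at `M P`, then `(1 - r) * x = 0` with `r ∈ M P`, so `1 - r ∉ P` and `x ∈ P`. Being in all
minimal primes, `x` is nilpotent, hence zero. -/
lemma Subalgebra.finite_perfectCore [Algebra.FiniteType k C] :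
    Module.Finite k (Subalgebra.perfectCore k p C) := by
  have : IsNoetherianRing C := Algebra.FiniteType.isNoetherianRing k C
  have := (minimalPrimes.finite_of_isNoetherianRing C).to_subtype
  have hmax : ∀ P : minimalPrimes C, ∃ M : Ideal C, M.IsMaximal ∧ P.1 ≤ M := fun P =>
    Ideal.exists_le_maximal _ P.2.1.1.ne_top
  choose M hM hPM using hmax
  have (P : minimalPrimes C) : Module.Finite k (C ⧸ M P) := by
    let _ := Ideal.Quotient.field (M P)
    exact finite_of_finite_type_of_isJacobsonRing k (C ⧸ M P)
  let f : Subalgebra.perfectCore k p C →ₗ[k] ∀ P : minimalPrimes C, C ⧸ M P :=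
    LinearMap.pi fun P =>
      ((Ideal.Quotient.mkₐ k (M P)).comp (Subalgebra.perfectCore k p C).val).toLinearMap
  refine Module.Finite.of_injective f ((injective_iff_map_eq_zero f).2 fun x hx => ?_)
  have hxP : ∀ P ∈ minimalPrimes C, (x : C) ∈ P := by
    intro P hP
    have h1 : (x : C) ∈ M ⟨P, hP⟩ := Ideal.Quotient.eq_zero_iff_mem.1 (congrFun hx ⟨P, hP⟩)
    obtain ⟨r, hr, h⟩ := Subalgebra.exists_mul_eq_of_mem_perfectCore
      (hM ⟨P, hP⟩).isPrime.isRadical x.2 h1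
    have h0 : (1 - r) * (x : C) ∈ P := by
      rw [sub_mul, one_mul, h, sub_self]
      exact zero_mem _
    refine (hP.1.1.mem_or_mem h0).resolve_left fun h2 => (hM ⟨P, hP⟩).ne_top ?_
    rw [Ideal.eq_top_iff_one]
    simpa using add_mem (hPM ⟨P, hP⟩ h2) hr
  have hnil : (x : C) ∈ nilradical C := by
    rw [nilradical, ← Ideal.sInf_minimalPrimes, Ideal.mem_sInf]
    exact fun {P} hP => hxP P hP
  have := Subalgebra.isReduced_perfectCore (k := k) (p := p) (C := C)
  obtain ⟨n, hn⟩ := hnil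
  exact eq_zero_of_pow_eq_zero (Subtype.ext hn : x ^ n = 0)

/-- A finite reduced algebra over a perfect field is étale. -/
lemma Algebra.Etale.of_finite_of_isReduced (k A : Type*) [Field k] [PerfectField k] [CommRing A]
    [Algebra k A] [Module.Finite k A] [IsReduced A] : Algebra.Etale k A := by
  have : IsArtinianRing A := IsArtinianRing.of_finite k A
  rw [Algebra.Etale.iff_exists_algEquiv_prod]
  let _ (I : MaximalSpectrum A) : Field (A ⧸ I.asIdeal) := Ideal.Quotient.field I.asIdeal
  refine ⟨MaximalSpectrum A, inferInstance, fun I => A ⧸ I.asIdeal, inferInstance,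
    fun I => inferInstance, (IsArtinianRing.equivPi A).restrictScalars k, fun I => ?_⟩
  have : Module.Finite k (A ⧸ I.asIdeal) :=
    Module.Finite.of_surjective (Ideal.Quotient.mkₐ k I.asIdeal).toLinearMap
      Ideal.Quotient.mk_surjective
  exact ⟨this, inferInstance⟩

end PerfectCore

open TensorProduct

/-! ### Algebras of `p ^ n`-th powers in a superalgebra. -/

namespace CSAlg

variable {k : Type u} [Field k]

lemma two_ne_zero_of_charP (k : Type u) [Field k] {p : ℕ} [CharP k p] (hp : 2 < p) :
    (2 : k) ≠ 0 := by
  intro h0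
  have : p ∣ 2 := (CharP.cast_eq_zero_iff k p 2).1 (by exact_mod_cast h0)
  exact absurd (Nat.le_of_dvd (by norm_num) this) (by omega)

/-- The even part of a superalgebra, as a subalgebra. -/
def even (A : CSAlg k) : Subalgebra k A where
  carrier := A.grading 0
  mul_mem' {a b} ha hb := SetLike.GradedMul.mul_mem (A := A.grading) (i := 0) (j := 0) ha hb
  add_mem' := add_mem
  algebraMap_mem' c := by
    rw [Algebra.algebraMap_eq_smul_one]
    exact Submodule.smul_mem _ _ (SetLike.GradedOne.one_mem (A := A.grading))

instance (A : CSAlg k) : CommRing A.even :=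
  { A.even.toRing with
    mul_comm := fun a b => Subtype.ext (A.commute_of_even a.2 b) }

instance (A : CSAlg k) [Nontrivial A] : Nontrivial A.even :=
  ⟨0, 1, fun h => zero_ne_one (congrArg Subtype.val h : (0 : A) = 1)⟩

instance (A : CSAlg k) [Nontrivial A] (p : ℕ) [CharP k p] : CharP A.even p :=
  charP_of_injective_algebraMap (algebraMap k A.even).injective p

/-- The inclusion of a subalgebra of the even part. -/
def evenIncl (A : CSAlg k) (S : Subalgebra k A.even) : Hom (ofComm k S) A :=
  ofCommHom (A.even.val.comp S.val) (fun s => s.1.2)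

lemma evenIncl_injective (A : CSAlg k) (S : Subalgebra k A.even) :
    Function.Injective (A.evenIncl S) := fun _ _ h => Subtype.ext (Subtype.ext h)

/-- A subalgebra of the even part, as a subspace of the superalgebra. -/
def evenRange (A : CSAlg k) (S : Subalgebra k A.even) : Submodule k A :=
  LinearMap.range (A.evenIncl S).toAlgHom.toLinearMap

lemma mem_evenRange {A : CSAlg k} {S : Subalgebra k A.even} {a : A} :
    a ∈ A.evenRange S ↔ ∃ h : a ∈ A.even, ⟨a, h⟩ ∈ S := by
  constructor
  · rintro ⟨s, rfl⟩
    exact ⟨s.1.2, s.2⟩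
  · rintro ⟨h, hs⟩
    exact ⟨⟨_, hs⟩, rfl⟩

section Frobenius

variable {p : ℕ} [Fact p.Prime] [CharP k p] (hp : 2 < p) (A : CSAlg k)

include hp

lemma add_pow_frob (n : ℕ) (a b : A) : (a + b) ^ p ^ n = a ^ p ^ n + b ^ p ^ n := by
  induction n with
  | zero => simp
  | succ n ih => rw [pow_succ, pow_mul, ih, A.frob_add hp, ← pow_mul, ← pow_mul]

lemma mul_pow_frob (n : ℕ) (a b : A) : (a * b) ^ p ^ n = a ^ p ^ n * b ^ p ^ n := by
  induction n with
  | zero => simp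
  | succ n ih => rw [pow_succ, pow_mul, ih, A.frob_mul hp, ← pow_mul, ← pow_mul]

/-- At least one `p`-th power is needed to kill the odd part, whence the exponents `n + 1` from here
on. -/
lemma exists_even_pow (n : ℕ) (a : A) : ∃ x : A.even, (x : A) ^ p ^ (n + 1) = a ^ p ^ (n + 1) := by
  obtain ⟨x, hx, y, hy, rfl⟩ := A.exists_even_odd a
  refine ⟨⟨x, hx⟩, ?_⟩
  rw [pow_succ', pow_mul, pow_mul, A.pow_eq_even_pow hp hx hy]

variable [PerfectField k] [Nontrivial A]

lemma pow_mem_evenRange_powers (n : ℕ) (a : A) :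
    a ^ p ^ (n + 1) ∈ A.evenRange (Subalgebra.powers k p A.even (n + 1)) := by
  obtain ⟨x, hx⟩ := A.exists_even_pow hp n a
  rw [← hx]
  exact ⟨⟨x ^ p ^ (n + 1), x, rfl⟩, rfl⟩

omit hp in
lemma exists_pow_of_mem_powers {n : ℕ} (s : Subalgebra.powers k p A.even n) :
    ∃ x : A.even, (x : A) ^ p ^ n = A.evenIncl _ s := by
  obtain ⟨x, hx⟩ := Subalgebra.mem_powers.1 s.2
  exact ⟨x, congrArg Subtype.val hx⟩

/-- Frobenius is additive and multiplicative on the super tensor product as well, so powers can be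
computed tensor by tensor. This makes algebras of powers stable under comultiplication. -/
lemma tensor_pow_mem (h2 : (2 : k) ≠ 0) (n : ℕ) (t : A.tensor A h2) :
    (tensorEquiv h2 A A).symm (t ^ p ^ (n + 1)) ∈ Submodule.map₂ (TensorProduct.mk k A A)
      (A.evenRange (Subalgebra.powers k p A.even (n + 1)))
      (A.evenRange (Subalgebra.powers k p A.even (n + 1))) := by
  induction t using tensor_span_induction with
  | add x y hx hy =>
    rw [add_pow_frob hp, map_add]
    exact add_mem hx hy
  | mul a b =>
    rw [mul_pow_frob hp, ← map_pow, ← map_pow, ← tensorEquiv_tmul, LinearEquiv.symm_apply_apply]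
    exact Submodule.apply_mem_map₂ _ (A.pow_mem_evenRange_powers hp n a)
      (A.pow_mem_evenRange_powers hp n b)

omit hp in
lemma evenRange_perfectCore : A.evenRange (Subalgebra.perfectCore k p A.even) =
    ⨅ n, A.evenRange (Subalgebra.powers k p A.even (n + 1)) := by
  ext a
  rw [Submodule.mem_iInf, mem_evenRange]
  simp only [mem_evenRange, Subalgebra.perfectCore, Algebra.mem_iInf]
  constructor
  · rintro ⟨h, H⟩ n
    exact ⟨h, H _⟩
  · intro H
    refine ⟨(H 0).1, fun n => ?_⟩
    exact Subalgebra.powers_antitone n.le_succ (H n).2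

end Frobenius

end CSAlg

/-! ### The algebras of powers and the perfect core are sub-Hopf-algebras. -/

namespace AffineSupergroup

open CSAlg

variable {k : Type u} [Field k]

instance (G : AffineSupergroup k) : Nontrivial G.coord :=
  ⟨0, 1, fun h => by
    have h1 : G.counit 0 = G.counit 1 := congrArg _ h
    rw [map_zero, map_one] at h1
    exact zero_ne_one (α := k) h1⟩

lemma isHopfSub_evenIncl (h2 : (2 : k) ≠ 0) (G : AffineSupergroup k) (S : Subalgebra k G.coord.even)
    (hΔ : ∀ s, (tensorEquiv h2 G.coord G.coord).symm
      (restr (G.coord.evenIncl S) (G.fst h2 * G.snd h2) s) ∈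
        Submodule.map₂ (TensorProduct.mk k G.coord G.coord) (G.coord.evenRange S)
          (G.coord.evenRange S))
    (hσ : ∀ s, restr (G.coord.evenIncl S) G.univ⁻¹ s ∈ G.coord.evenRange S) :
    IsHopfSub h2 G (G.coord.evenIncl S) where
  injective := evenIncl_injective _ _
  comul s := by
    have := hΔ s
    rw [evenRange, ← TensorProduct.range_map] at this
    obtain ⟨t, ht⟩ := this
    refine ⟨t, ?_⟩
    rw [ofCommTensor_eq, ht, LinearEquiv.apply_symm_apply]
  antipode := hσ

variable {p : ℕ} [Fact p.Prime] [CharP k p] [PerfectField k]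

/-- Points are algebra maps and preserve powers. It is applied to the points that encode
comultiplication and antipode. -/
lemma restr_mem_powers (G : AffineSupergroup k) {A : CSAlg k} (g : G.Points A)
    {n : ℕ} (s : Subalgebra.powers k p G.coord.even n) :
    ∃ a : A, a ^ p ^ n = restr (G.coord.evenIncl _) g s := by
  obtain ⟨x, hx⟩ := G.coord.exists_pow_of_mem_powers s
  refine ⟨(show CSAlg.Hom G.coord A from g) x, ?_⟩
  rw [← map_pow, hx]
  rfl

lemma isHopfSub_powers (h2 : (2 : k) ≠ 0) (hp : 2 < p) (G : AffineSupergroup k) (n : ℕ) :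
    IsHopfSub h2 G (G.coord.evenIncl (Subalgebra.powers k p G.coord.even (n + 1))) := by
  refine isHopfSub_evenIncl h2 G _ (fun s => ?_) (fun s => ?_)
  · obtain ⟨a, ha⟩ := G.restr_mem_powers (G.fst h2 * G.snd h2) s
    rw [← ha]
    exact tensor_pow_mem hp G.coord h2 n a
  · obtain ⟨a, ha⟩ := G.restr_mem_powers G.univ⁻¹ s
    rw [← ha]
    exact pow_mem_evenRange_powers hp G.coord n a

/-- Comultiplication lands in the tensor square of each algebra of powers, hence in that of the
intersection by `TensorProduct.mem_map₂_mk_iInf`. -/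
lemma isHopfSub_perfectCore (h2 : (2 : k) ≠ 0) (hp : 2 < p) (G : AffineSupergroup k) :
    IsHopfSub h2 G (G.coord.evenIncl (Subalgebra.perfectCore k p G.coord.even)) := by
  have hle : ∀ n, Subalgebra.perfectCore k p G.coord.even ≤
    Subalgebra.powers k p G.coord.even n := fun n => iInf_le _ n
  refine isHopfSub_evenIncl h2 G _ (fun s => ?_) (fun s => ?_)
  · rw [evenRange_perfectCore]
    refine TensorProduct.mem_map₂_mk_iInf _ fun n => ?_
    obtain ⟨a, ha⟩ := G.restr_mem_powers (G.fst h2 * G.snd h2)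
      (n := n + 1) ⟨s, hle _ s.2⟩
    change (tensorEquiv h2 G.coord G.coord).symm (restr (G.coord.evenIncl _) (G.fst h2 * G.snd h2)
      (⟨s, hle _ s.2⟩ : Subalgebra.powers k p G.coord.even (n + 1))) ∈ _
    rw [← ha]
    exact tensor_pow_mem hp G.coord h2 n a
  · rw [evenRange_perfectCore, Submodule.mem_iInf]
    intro n
    obtain ⟨a, ha⟩ := G.restr_mem_powers G.univ⁻¹ (n := n + 1) ⟨s, hle _ s.2⟩
    change restr (G.coord.evenIncl _) G.univ⁻¹
      (⟨s, hle _ s.2⟩ : Subalgebra.powers k p G.coord.even (n + 1)) ∈ _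
    rw [← ha]
    exact pow_mem_evenRange_powers hp G.coord n a

end AffineSupergroup

/-! ### Projectivity of a finite module whose tensor square is a power of itself. -/

section Descent

variable {B : Type*} [CommRing B]

/-- If `s` maps a Noetherian module into the range of an endomorphism `g`, then a power of `s`
annihilates the kernel of `g`. -/
lemma LinearMap.exists_pow_smul_eq_zero_of_smul_mem_range {L : Type*} [AddCommGroup L] [Module B L]
    [IsNoetherian B L] (g : L →ₗ[B] L) (s : B) (hs : ∀ x, s • x ∈ LinearMap.range g) :
    ∃ N : ℕ, ∀ x, g x = 0 → s ^ N • x = 0 := by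
  have hpow : ∀ (n : ℕ) (x : L), ∃ y, (g ^ n) y = s ^ n • x := by
    intro n
    induction n with
    | zero => exact fun x => ⟨x, by simp⟩
    | succ n ih =>
      intro x
      obtain ⟨y, hy⟩ := hs x
      obtain ⟨z, hz⟩ := ih y
      refine ⟨z, ?_⟩
      rw [pow_succ', Module.End.mul_apply, hz, map_smul, hy, smul_smul, ← pow_succ]
  -- A Fitting argument: let the kernels of `g ^ n` be stationary from `N` on and write `s ^ N • x =
  -- (g ^ N) y`. If `g x = 0`, then `y` is killed by `g ^ (N + 1)`, hence by `g ^ N`.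
  obtain ⟨N, hN⟩ := monotone_stabilizes_iff_noetherian.2 ‹_› g.iterateKer
  refine ⟨N, fun x hx => ?_⟩
  obtain ⟨y, hy⟩ := hpow N x
  have h1 : y ∈ g.iterateKer (N + 1) := by
    change (g ^ (N + 1)) y = 0
    rw [pow_succ', Module.End.mul_apply, hy, map_smul, hx, smul_zero]
  rw [← hN _ N.le_succ] at h1
  rw [← hy]
  exact h1

/-- Nakayama's lemma for `M ⧸ N`, with an explicit denominator `s` in place of localization. -/
lemma exists_smul_mem_of_sup_smul_eq_top {M : Type*} [AddCommGroup M] [Module B M]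
    [Module.Finite B M] (I : Ideal B) (N : Submodule B M) (h : N ⊔ I • ⊤ = ⊤) :
    ∃ s : B, s - 1 ∈ I ∧ ∀ x : M, s • x ∈ N := by
  have h1 : (⊤ : Submodule B (M ⧸ N)) ≤ I • ⊤ := by
    have := congrArg (Submodule.map N.mkQ) h
    rw [Submodule.map_sup, Submodule.map_smul'', Submodule.map_top, Submodule.range_mkQ,
      Submodule.mkQ_map_self, bot_sup_eq] at this
    exact this.ge
  obtain ⟨s, hs, h2⟩ :=
    Submodule.exists_sub_one_mem_and_smul_eq_zero_of_fg_of_le_smul I _ Module.Finite.fg_top h1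
  refine ⟨s, hs, fun x => ?_⟩
  rw [← Submodule.Quotient.mk_eq_zero, Submodule.Quotient.mk_smul]
  exact h2 _ trivial

/-- A tensor representing the identity is a finite dual basis. -/
lemma Module.Projective.of_id_mem_range_dualTensorHom {M : Type*} [AddCommGroup M] [Module B M]
    (h : LinearMap.id ∈ LinearMap.range (dualTensorHom B M M)) : Module.Projective B M := by
  obtain ⟨t, ht⟩ := h
  obtain ⟨n, f, m, rfl⟩ : ∃ (n : ℕ) (f : Fin n → Module.Dual B M) (m : Fin n → M),
      t = ∑ i, f i ⊗ₜ m i := by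
    obtain ⟨S, rfl⟩ := TensorProduct.exists_finset t
    let e := S.equivFin
    refine ⟨S.card, fun i => (e.symm i).1.1, fun i => (e.symm i).1.2, ?_⟩
    rw [← Finset.sum_coe_sort S, ← e.symm.sum_comp]
  refine Module.Projective.of_split (LinearMap.pi f)
    (Fintype.linearCombination B m) (LinearMap.ext fun x => ?_)
  rw [LinearMap.comp_apply, Fintype.linearCombination_apply, ← ht]
  simp [dualTensorHom_apply]

lemma LinearMap.comp_mem_range_dualTensorHom {M : Type*} [AddCommGroup M] [Module B M] {n : ℕ}
    (q : (Fin n → B) →ₗ[B] M) (h : M →ₗ[B] Fin n → B) :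
    q ∘ₗ h ∈ LinearMap.range (dualTensorHom B M M) := by
  refine ⟨∑ i, (LinearMap.proj i ∘ₗ h) ⊗ₜ q (Pi.single i 1), LinearMap.ext fun x => ?_⟩
  rw [LinearMap.comp_apply, LinearMap.pi_apply_eq_sum_univ q (h x)]
  have hs : ∀ i : Fin n, (Pi.single i 1 : Fin n → B) = fun j => if i = j then 1 else 0 := by
    intro i
    ext j
    simp [Pi.single_apply, eq_comm]
  simp [dualTensorHom_apply, hs]

variable {R : Type*} [AddCommGroup R] [Module B R] [Module.Finite B R]

lemma nontrivial_residue_tensor {e : R} (he : ∀ b : B, b • e = 0 → b = 0) (I : Ideal B)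
    (hI : I ≠ ⊤) : Nontrivial ((B ⧸ I) ⊗[B] R) := by
  rw [(TensorProduct.quotTensorEquivQuotSMul R I).toEquiv.nontrivial_congr,
    Submodule.Quotient.nontrivial_iff]
  intro h
  obtain ⟨s, hs, h2⟩ := exists_smul_mem_of_sup_smul_eq_top I (⊥ : Submodule B R)
    (by rw [h, bot_sup_eq])
  have : s = 0 := he s (h2 e)
  rw [this, zero_sub, neg_mem_iff] at hs
  exact hI ((Ideal.eq_top_iff_one I).2 hs)

/-- Reducing `φ` modulo `I` gives `d * d = n * d` for the dimension `d` of the fibre, and `d ≠ 0`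
because `e` has zero annihilator. -/
lemma finrank_residue_tensor {e : R} (he : ∀ b : B, b • e = 0 → b = 0) {n : ℕ}
    (φ : R ⊗[B] R ≃ₗ[B] (Fin n → R)) (I : Ideal B) [I.IsMaximal] :
    Module.finrank (B ⧸ I) ((B ⧸ I) ⊗[B] R) = n := by
  let _ := Ideal.Quotient.field I
  have := nontrivial_residue_tensor he I (Ideal.IsMaximal.ne_top ‹_›)
  have hd : 0 < Module.finrank (B ⧸ I) ((B ⧸ I) ⊗[B] R) := Module.finrank_pos
  have e1 : ((B ⧸ I) ⊗[B] R) ⊗[B ⧸ I] ((B ⧸ I) ⊗[B] R) ≃ₗ[B ⧸ I] (Fin n → (B ⧸ I) ⊗[B] R) :=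
    (TensorProduct.AlgebraTensorModule.distribBaseChange B (B ⧸ I) R R).symm ≪≫ₗ
      φ.baseChange B (B ⧸ I) _ _ ≪≫ₗ
      TensorProduct.piRight B (B ⧸ I) (B ⧸ I) (fun _ : Fin n => R)
  have := e1.finrank_eq
  rw [Module.finrank_tensorProduct, Module.finrank_pi_fintype] at this
  simp only [Finset.sum_const, Finset.card_univ, Fintype.card_fin, smul_eq_mul] at this
  exact Nat.eq_of_mul_eq_mul_right hd this

/-- A basis of the fibre at `I` lifts to `q : B ^ n → R`, which is surjective up to some `s ∉ I`.
After tensoring with `R` and applying `φ` it becomes an endomorphism of `R ^ n` whose image contains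
`s • R ^ n`, so a power of `s` kills its kernel and therefore `ker q`. Hence a power of `s` factors
through `B ^ n`. -/
lemma exists_smul_id_mem_range_dualTensorHom [IsNoetherianRing B] {e : R}
    (he : ∀ b : B, b • e = 0 → b = 0) {n : ℕ} (φ : R ⊗[B] R ≃ₗ[B] (Fin n → R)) (I : Ideal B)
    [hI : I.IsMaximal] : ∃ s ∉ I, s • LinearMap.id ∈ LinearMap.range (dualTensorHom B R R) := by
  let _ := Ideal.Quotient.field I
  have hsurj : ∀ z : (B ⧸ I) ⊗[B] R, ∃ m : R, (1 : B ⧸ I) ⊗ₜ[B] m = z := by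
    intro z
    exact TensorProduct.mk_surjective B R (B ⧸ I) Ideal.Quotient.mk_surjective z
  let b := Module.finBasisOfFinrankEq (B ⧸ I) ((B ⧸ I) ⊗[B] R) (finrank_residue_tensor he φ I)
  choose m hm using fun i => hsurj (b i)
  let q : (Fin n → B) →ₗ[B] R := Fintype.linearCombination B m
  have hq : ∀ y, q y = ∑ i, y i • m i := Fintype.linearCombination_apply B m
  have htop : LinearMap.range q ⊔ I • ⊤ = ⊤ := by
    rw [eq_top_iff]
    intro x _
    let c := b.repr ((1 : B ⧸ I) ⊗ₜ[B] x)
    choose y hy using fun i => Ideal.Quotient.mk_surjective (c i)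
    have h1 : (1 : B ⧸ I) ⊗ₜ[B] (x - q y) = 0 := by
      rw [TensorProduct.tmul_sub, sub_eq_zero, ← b.sum_repr ((1 : B ⧸ I) ⊗ₜ[B] x), hq,
        TensorProduct.tmul_sum]
      refine Finset.sum_congr rfl fun i _ => ?_
      rw [TensorProduct.tmul_smul, hm, ← hy i]
      rfl
    have h2 : x - q y ∈ (I • ⊤ : Submodule B R) := by
      rw [← Submodule.Quotient.mk_eq_zero]
      have := congrArg (TensorProduct.quotTensorEquivQuotSMul R I) h1
      rw [map_zero, ← map_one (Ideal.Quotient.mk I),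
        TensorProduct.quotTensorEquivQuotSMul_mk_tmul, one_smul] at this
      exact this
    rw [← add_sub_cancel (q y) x]
    exact Submodule.add_mem_sup ⟨y, rfl⟩ h2
  obtain ⟨s, hs, hsq⟩ := exists_smul_mem_of_sup_smul_eq_top I _ htop
  let f : (Fin n → R) →ₗ[B] R ⊗[B] R :=
    ∑ i, ((TensorProduct.mk B R R).flip (m i)) ∘ₗ LinearMap.proj i
  have hf : ∀ r, f r = ∑ i, r i ⊗ₜ m i := fun r => by simp [f]
  have hsf : ∀ z, s • z ∈ LinearMap.range f := by
    intro z
    induction z using TensorProduct.induction_on with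
    | zero => simp
    | add x y hx hy => rw [smul_add]; exact add_mem hx hy
    | tmul x y =>
      obtain ⟨c, hc⟩ := hsq y
      refine ⟨fun i => c i • x, ?_⟩
      rw [hf, ← TensorProduct.tmul_smul, ← hc, hq, TensorProduct.tmul_sum]
      simp [TensorProduct.smul_tmul]
  obtain ⟨N, hN⟩ := LinearMap.exists_pow_smul_eq_zero_of_smul_mem_range (φ.toLinearMap ∘ₗ f) s
    (fun x => by
      obtain ⟨y, hy⟩ := hsf (φ.symm x)
      exact ⟨y, by simp [hy]⟩)
  have hker : LinearMap.ker q ≤ LinearMap.ker (s ^ N • LinearMap.id : (Fin n → B) →ₗ[B] _) := by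
    intro y hy
    -- Multiplying `e` by the coordinates of `y` moves a relation in `ker q` into `ker f`; the zero
    -- annihilator of `e` brings the conclusion back to `B`.
    have h1 : f (fun i => y i • e) = 0 := by
      rw [hf]
      have : e ⊗ₜ[B] q y = 0 := by rw [LinearMap.mem_ker.1 hy, TensorProduct.tmul_zero]
      rw [← this, hq, TensorProduct.tmul_sum]
      simp [TensorProduct.smul_tmul]
    have h2 := hN _ (by rw [LinearMap.comp_apply, h1, map_zero])
    refine funext fun i => he _ ?_
    have := congrFun h2 i
    simpa [smul_smul] using this
  -- `h x` is `s ^ N • y` for any `y` with `q y = s • x`; it is independent of `y` because `s ^ N`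
  -- kills `ker q`.
  let h : R →ₗ[B] Fin n → B := (LinearMap.ker q).liftQ _ hker ∘ₗ
    q.quotKerEquivRange.symm.toLinearMap ∘ₗ
      LinearMap.codRestrict (LinearMap.range q) (s • LinearMap.id) hsq
  have hqh : q ∘ₗ h = s ^ (N + 1) • LinearMap.id := by
    ext x
    obtain ⟨y, hy⟩ := hsq x
    have h1 : LinearMap.codRestrict (LinearMap.range q) (s • LinearMap.id) hsq x =
        q.quotKerEquivRange (Submodule.Quotient.mk y) := Subtype.ext hy.symm
    have h2 : h x = s ^ N • y := by
      simp only [h, LinearMap.comp_apply, h1, LinearEquiv.coe_coe, LinearEquiv.symm_apply_apply]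
      rfl
    rw [LinearMap.comp_apply, h2, map_smul, hy, pow_succ, mul_smul]
    rfl
  refine ⟨s ^ (N + 1), fun hmem => ?_, hqh ▸ LinearMap.comp_mem_range_dualTensorHom q h⟩
  have hsI := hI.isPrime.mem_of_pow_mem _ hmem
  refine hI.ne_top ((Ideal.eq_top_iff_one I).2 ?_)
  simpa using sub_mem hsI hs

/-- A finite module `R ⊇ B` over a Noetherian ring `B` is projective if `R ⊗ R` is isomorphic to
a power of `R`. -/
lemma Module.Projective.of_tensor_self_equiv_pi [IsNoetherianRing B] {e : R}
    (he : ∀ b : B, b • e = 0 → b = 0) {n : ℕ} (φ : R ⊗[B] R ≃ₗ[B] (Fin n → R)) :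
    Module.Projective B R := by
  apply Module.Projective.of_id_mem_range_dualTensorHom
  -- The scalars whose multiplication map comes from `dualTensorHom` form an ideal, which the local
  -- statement keeps out of every maximal ideal.
  let I : Ideal B := (LinearMap.range (dualTensorHom B R R)).comap
    (LinearMap.toSpanSingleton B (R →ₗ[B] R) LinearMap.id)
  have hI : I = ⊤ := by
    by_contra h
    obtain ⟨J, hJ, hIJ⟩ := Ideal.exists_le_maximal I h
    obtain ⟨s, hs, h1⟩ := exists_smul_id_mem_range_dualTensorHom he φ J
    exact hs (hIJ h1)
  have : (1 : B) ∈ I := hI ▸ Submodule.mem_top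
  simpa [I] using this

end Descent

/-! ### Finiteness of a finitely generated superalgebra over its algebras of powers. -/

namespace CSAlg

variable {k : Type u} [Field k]

instance evenAlgebra (A : CSAlg k) : Algebra A.even A where
  algebraMap := A.even.val.toRingHom
  commutes' a b := A.commute_of_even a.2 b
  smul_def' _ _ := rfl

lemma smul_even_def (A : CSAlg k) (S : Subalgebra k A.even) (s : S) (a : A) :
    s • a = A.evenIncl S s * a := rfl

section Finite

/-- Homogeneous elements commute up to sign. -/
lemma mul_comm_or_neg (A : CSAlg k) {i j : ZMod 2} {a b : A} (ha : a ∈ A.grading i)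
    (hb : b ∈ A.grading j) : a * b = b * a ∨ a * b = -(b * a) := by
  rw [A.comm ha hb]
  rcases neg_one_pow_eq_or A (i.val * j.val) with h | h <;> simp [h]

lemma mul_pow_comm_or_neg (A : CSAlg k) {i j : ZMod 2} {a b : A} (ha : a ∈ A.grading i)
    (hb : b ∈ A.grading j) (n : ℕ) : a * b ^ n = b ^ n * a ∨ a * b ^ n = -(b ^ n * a) := by
  induction n with
  | zero => simp
  | succ n ih =>
    rw [pow_succ, ← mul_assoc]
    rcases ih with h | h <;> rcases A.mul_comm_or_neg ha hb with h' | h' <;>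
      simp [h, mul_assoc, h']

variable (A : CSAlg k) (S : Subalgebra k A.even)

lemma mul_span_pow {n : ℕ} {i j : ZMod 2} {x y : A} (hx : x ∈ A.grading i) (hy : y ∈ A.grading j)
    {u : A} (hu : u ∈ Submodule.span S ((fun e => x ^ e) '' Set.Iio n)) :
    ∃ u' ∈ Submodule.span S ((fun e => x ^ e) '' Set.Iio n), y * u = u' * y := by
  induction hu using Submodule.span_induction with
  | zero => exact ⟨0, zero_mem _, by simp⟩
  | add u v _ _ hu hv =>
    obtain ⟨u', hu', h⟩ := hu
    obtain ⟨v', hv', h'⟩ := hv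
    exact ⟨u' + v', add_mem hu' hv', by rw [mul_add, add_mul, h, h']⟩
  | smul c u _ hu =>
    obtain ⟨u', hu', h⟩ := hu
    exact ⟨c • u', Submodule.smul_mem _ _ hu', by rw [mul_smul_comm, h, smul_mul_assoc]⟩
  | mem u hu =>
    have hu' := Submodule.subset_span (R := S) hu
    obtain ⟨e, -, rfl⟩ := hu
    rcases A.mul_pow_comm_or_neg hy hx e with h | h
    · exact ⟨_, hu', h⟩
    · exact ⟨_, neg_mem hu', by rw [neg_mul]; exact h⟩

/-- A finitely generated submodule stable under left multiplication by given homogeneous elements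
whose `n`-th powers are scalars. -/
lemma exists_fg_stable {n : ℕ} (hn : 0 < n) (l : List A)
    (hl : ∀ x ∈ l, (∃ i, x ∈ A.grading i) ∧ ∃ s : S, x ^ n = s • 1) :
    ∃ L : Submodule S A, L.FG ∧ 1 ∈ L ∧ (∀ x ∈ l, ∀ z ∈ L, x * z ∈ L) ∧
      ∀ i, ∀ y ∈ A.grading i, ∀ z ∈ L, ∃ z' ∈ L, y * z = z' * y := by
  induction l with
  | nil =>
    refine ⟨1, Submodule.one_eq_span (R := S) (A := A) ▸ Submodule.fg_span_singleton 1,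
      Submodule.one_le.1 le_rfl, by simp, ?_⟩
    intro i y _ z hz
    obtain ⟨s, rfl⟩ := Submodule.mem_one.1 hz
    exact ⟨_, hz, (Algebra.commutes s y).symm⟩
  | cons x l ih =>
    obtain ⟨L, hfg, hone, hL, hc⟩ := ih fun y hy => hl y (List.mem_cons_of_mem _ hy)
    obtain ⟨⟨i, hx⟩, s, hs⟩ := hl x List.mem_cons_self
    -- The new module is `X * L`. The relation `x ^ n ∈ S` closes `X` under `x`, and homogeneous
    -- elements move past `X` and `L`, which is why the last clause is carried through the
    -- induction.
    let X := Submodule.span S ((fun e => x ^ e) '' Set.Iio n)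
    have hXc : ∀ i, ∀ y ∈ A.grading i, ∀ z ∈ X, ∃ z' ∈ X, y * z = z' * y := fun j y hy z hz =>
      A.mul_span_pow S hx hy hz
    have hX1 : (1 : A) ∈ X := Submodule.subset_span ⟨0, hn, pow_zero x⟩
    have hXx : ∀ z ∈ X, x * z ∈ X := by
      intro z hz
      induction hz using Submodule.span_induction with
      | zero => simp
      | add u v _ _ hu hv => rw [mul_add]; exact add_mem hu hv
      | smul c u _ hu => rw [mul_smul_comm]; exact Submodule.smul_mem _ _ hu
      | mem u hu =>
        obtain ⟨e, he, rfl⟩ := hu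
        change x * x ^ e ∈ X
        rw [← pow_succ']
        rcases (Nat.succ_le_of_lt he).lt_or_eq with h | h
        · exact Submodule.subset_span ⟨e + 1, h, rfl⟩
        · rw [show e + 1 = n from h, hs]
          exact Submodule.smul_mem _ _ hX1
    refine ⟨X * L, (Submodule.fg_span ((Set.finite_Iio n).image _)).mul hfg, ?_, ?_, ?_⟩
    · simpa using Submodule.mul_mem_mul hX1 hone
    · intro y hy z hz
      refine Submodule.mul_induction_on hz (fun u hu v hv => ?_) fun u v hu hv => ?_
      · rcases List.mem_cons.1 hy with rfl | hy
        · rw [← mul_assoc]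
          exact Submodule.mul_mem_mul (hXx _ hu) hv
        · obtain ⟨⟨j, hyj⟩, -⟩ := hl y (List.mem_cons_of_mem _ hy)
          obtain ⟨u', hu', h⟩ := hXc j y hyj u hu
          rw [← mul_assoc, h, mul_assoc]
          exact Submodule.mul_mem_mul hu' (hL y hy v hv)
      · rw [mul_add]
        exact add_mem hu hv
    · intro j y hy z hz
      refine Submodule.mul_induction_on hz (fun u hu v hv => ?_) fun u v hu hv => ?_
      · obtain ⟨u', hu', h⟩ := hXc j y hy u hu
        obtain ⟨v', hv', h'⟩ := hc j y hy v hv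
        exact ⟨u' * v', Submodule.mul_mem_mul hu' hv', by
          rw [← mul_assoc, h, mul_assoc, h', mul_assoc]⟩
      · obtain ⟨u', hu', h⟩ := hu
        obtain ⟨v', hv', h'⟩ := hv
        exact ⟨u' + v', add_mem hu' hv', by rw [mul_add, add_mul, h, h']⟩

variable {A}

lemma exists_homogeneous_generators (hA : Algebra.FiniteType k A) :
    ∃ l : List A, (∀ x ∈ l, ∃ i, x ∈ A.grading i) ∧ Algebra.adjoin k {x | x ∈ l} = ⊤ := by
  classical
  obtain ⟨s, hs⟩ := hA.out
  choose e he o ho heo using A.exists_even_odd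
  refine ⟨s.toList.map e ++ s.toList.map o, ?_, ?_⟩
  · intro x hx
    rw [List.mem_append, List.mem_map, List.mem_map] at hx
    rcases hx with ⟨a, -, rfl⟩ | ⟨a, -, rfl⟩
    · exact ⟨0, he a⟩
    · exact ⟨1, ho a⟩
  · rw [eq_top_iff, ← hs, Algebra.adjoin_le_iff]
    intro a ha
    rw [SetLike.mem_coe, heo a]
    have ha' : a ∈ s.toList := Finset.mem_toList.2 ha
    refine add_mem (Algebra.subset_adjoin ?_) (Algebra.subset_adjoin ?_)
    · exact List.mem_append_left _ (List.mem_map_of_mem ha')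
    · exact List.mem_append_right _ (List.mem_map_of_mem ha')

lemma finite_of_pow_mem (hA : Algebra.FiniteType k A) {n : ℕ} (hn : 0 < n)
    (hS : ∀ a : A, ∃ s : S, a ^ n = s • 1) : Module.Finite S A := by
  obtain ⟨l, hl, htop⟩ := exists_homogeneous_generators hA
  obtain ⟨L, hfg, hone, hL, -⟩ := A.exists_fg_stable S hn l fun x hx => ⟨hl x hx, hS x⟩
  have hLtop : L = ⊤ := by
    rw [eq_top_iff]
    rintro a -
    have ha : a ∈ Algebra.adjoin k {x | x ∈ l} := htop ▸ trivial
    have : ∀ z ∈ L, a * z ∈ L := by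
      induction ha using Algebra.adjoin_induction with
      | mem x hx => exact hL x hx
      | algebraMap c =>
        intro z hz
        have : algebraMap k A c * z = (algebraMap k S c) • z := rfl
        rw [this]
        exact L.smul_mem _ hz
      | add x y _ _ hx hy => intro z hz; rw [add_mul]; exact add_mem (hx z hz) (hy z hz)
      | mul x y _ _ hx hy => intro z hz; rw [mul_assoc]; exact hx _ (hy z hz)
    simpa using this 1 hone
  exact ⟨hLtop ▸ hfg⟩

section Powers

variable {p : ℕ} [Fact p.Prime] [CharP k p] [PerfectField k] [Nontrivial A] (hp : 2 < p)

include hp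

lemma finite_powers (hA : Algebra.FiniteType k A) (n : ℕ) :
    Module.Finite (Subalgebra.powers k p A.even (n + 1)) A := by
  refine finite_of_pow_mem _ hA (n := p ^ (n + 1)) (pow_pos (by omega) _) fun a => ?_
  obtain ⟨s, hs⟩ := A.pow_mem_evenRange_powers hp n a
  exact ⟨s, by rw [smul_even_def, mul_one]; exact hs.symm⟩

/-- The power map is a surjective ring homomorphism from `A` onto this algebra and is semilinear
over Frobenius, so powers of generators generate. -/
lemma finiteType_powers (hA : Algebra.FiniteType k A) (n : ℕ) :
    Algebra.FiniteType k (Subalgebra.powers k p A.even (n + 1)) := by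
  classical
  obtain ⟨s, hs⟩ := hA.out
  choose f hf using fun a => A.pow_mem_evenRange_powers hp n a
  replace hf : ∀ a, A.evenIncl _ (f a) = a ^ p ^ (n + 1) := hf
  refine ⟨⟨s.image f, ?_⟩⟩
  rw [eq_top_iff]
  intro b _
  obtain ⟨x, hx⟩ := A.exists_pow_of_mem_powers b
  have key : ∀ a : A, f a ∈ Algebra.adjoin k (s.image f : Set _) := by
    intro a
    have ha : a ∈ Algebra.adjoin k (s : Set A) := hs ▸ trivial
    induction ha using Algebra.adjoin_induction with
    | mem x hx => exact Algebra.subset_adjoin (by simpa using ⟨x, hx, rfl⟩)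
    | algebraMap c =>
      have : f (algebraMap k A c) = algebraMap k _ (c ^ p ^ (n + 1)) := by
        apply A.evenIncl_injective
        rw [hf, ← map_pow]
        rfl
      rw [this]
      exact Subalgebra.algebraMap_mem _ _
    | add x y _ _ hx hy =>
      have : f (x + y) = f x + f y := by
        apply A.evenIncl_injective
        refine Eq.trans ?_ (map_add (A.evenIncl _) _ _).symm
        rw [hf, hf, hf, add_pow_frob hp]
      rw [this]
      exact add_mem hx hy
    | mul x y _ _ hx hy =>
      have : f (x * y) = f x * f y := by
        apply A.evenIncl_injective
        refine Eq.trans ?_ (map_mul (A.evenIncl _) _ _).symm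
        rw [hf, hf, hf, mul_pow_frob hp]
      rw [this]
      exact mul_mem hx hy
  have : b = f x := A.evenIncl_injective _ (by rw [hf, hx])
  rw [this]
  exact key x

/-- The even part is a submodule of `A`, which is finite over the Noetherian algebra of `p`-th
powers. -/
lemma finiteType_even (hA : Algebra.FiniteType k A) : Algebra.FiniteType k A.even := by
  have := finite_powers hp hA 0
  have h1 := finiteType_powers hp hA 0
  have : IsNoetherianRing (Subalgebra.powers k p A.even (0 + 1)) :=
    Algebra.FiniteType.isNoetherianRing k _
  have : Module.Finite (Subalgebra.powers k p A.even (0 + 1)) A.even :=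
    Module.Finite.of_injective
      ({ toFun := fun a => (a : A), map_add' := fun _ _ => rfl, map_smul' := fun _ _ => rfl } :
        A.even →ₗ[Subalgebra.powers k p A.even (0 + 1)] A) Subtype.val_injective
  exact Algebra.FiniteType.trans h1 inferInstance

end Powers

end Finite

end CSAlg

namespace AffineSupergroup

open CSAlg

variable {k : Type u} [Field k]

/-! ### The torsor isomorphism and projectivity over sub-Hopf-algebras. -/

section Torsor

variable (h2 : (2 : k) ≠ 0) (G : AffineSupergroup k) (S : Subalgebra k G.coord.even)

/-- The elements of a subalgebra of `k[G]` lying in the augmentation ideal. -/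
def augElements : Set G.coord := G.coord.evenIncl S '' {b | G.counit (G.coord.evenIncl S b) = 0}

/-- The copy of the augmentation ideal of a subalgebra in the second factor of `k[G] ⊗ k[G]`. -/
def sndAug : Set (G.coord.tensor G.coord h2) := inr h2 G.coord G.coord '' G.augElements S

/-- The relations defining `k[G] ⊗_S k[G]` as a quotient of `k[G] ⊗ k[G]`. -/
def balanced : Set (G.coord.tensor G.coord h2) :=
  Set.range fun b : S => inl h2 G.coord G.coord (G.coord.evenIncl S b) -
    inr h2 G.coord G.coord (G.coord.evenIncl S b)

lemma sndAug_even : G.sndAug h2 S ⊆ (G.coord.tensor G.coord h2).grading 0 := by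
  rintro _ ⟨_, ⟨b, -, rfl⟩, rfl⟩
  exact Hom.map_mem_grading _ b.1.2

lemma balanced_even : G.balanced h2 S ⊆ (G.coord.tensor G.coord h2).grading 0 := by
  rintro _ ⟨b, rfl⟩
  exact sub_mem (Hom.map_mem_grading _ b.1.2) (Hom.map_mem_grading _ b.1.2)

variable {S}

lemma sub_algebraMap_mem_augElements (b : S) :
    G.coord.evenIncl S b - algebraMap k _ (G.counit (G.coord.evenIncl S b)) ∈ G.augElements S := by
  refine ⟨b - algebraMap k S (G.counit (G.coord.evenIncl S b)), ?_, rfl⟩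
  exact G.counit_sub (G.coord.evenIncl S b)

variable (hS : IsHopfSub h2 G (G.coord.evenIncl S))

include hS

/-- Modulo `sndAug` the second universal point `h` becomes trivial in `Spec S`, so `gh` and `g`
agree on `S`. -/
lemma mul_sub_inl_mem_span (b : S) :
    (show CSAlg.Hom G.coord _ from G.fst h2 * G.snd h2) (G.coord.evenIncl S b) -
      inl h2 G.coord G.coord (G.coord.evenIncl S b) ∈ Ideal.span (G.sndAug h2 S) := by
  let q := (G.coord.tensor G.coord h2).quotMk h2 _ (G.sndAug_even h2 S)
  have h1 : restr (G.coord.evenIncl S) (G.map q (G.snd h2)) =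
      IsHopfSub.one (G.coord.evenIncl S) _ := by
    ext b
    rw [← IsHopfSub.restr_one]
    have h3 := (quotMk_eq_zero_iff h2 _ _ (G.sndAug_even h2 S)).2
      (Ideal.subset_span ⟨_, G.sub_algebraMap_mem_augElements b, rfl⟩)
    rw [map_sub, map_sub, sub_eq_zero, GradedAlgHom.commutes, GradedAlgHom.commutes] at h3
    refine h3.trans ?_
    exact (G.one_apply _).symm
  have h3 := hS.restr_mul (G.map q (G.fst h2)) (G.map q (G.snd h2))
  rw [h1, hS.mul_one, ← map_mul] at h3
  rw [← quotMk_eq_zero_iff h2 _ _ (G.sndAug_even h2 S), map_sub, sub_eq_zero]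
  exact congrArg (fun f => f b) h3

/-- Modulo `balanced` both universal points have the same image in `Spec S`, so `g⁻¹h` becomes
trivial there. -/
lemma inv_mul_mem_span {b : S} (hb : G.counit (G.coord.evenIncl S b) = 0) :
    (show CSAlg.Hom G.coord _ from (G.fst h2)⁻¹ * G.snd h2) (G.coord.evenIncl S b) ∈
      Ideal.span (G.balanced h2 S) := by
  let q := (G.coord.tensor G.coord h2).quotMk h2 _ (G.balanced_even h2 S)
  have h1 : restr (G.coord.evenIncl S) (G.map q (G.fst h2)) =
      restr (G.coord.evenIncl S) (G.map q (G.snd h2)) := by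
    ext b
    have h3 := (quotMk_eq_zero_iff h2 _ _ (G.balanced_even h2 S)).2 (Ideal.subset_span ⟨b, rfl⟩)
    rw [map_sub, sub_eq_zero] at h3
    exact h3
  have h3 := hS.restr_mul (G.map q (G.fst h2))⁻¹ (G.map q (G.snd h2))
  rw [hS.restr_inv, h1, hS.inv_mul_cancel, ← IsHopfSub.restr_one, ← map_inv, ← map_mul] at h3
  rw [← quotMk_eq_zero_iff h2 _ _ (G.balanced_even h2 S)]
  refine (congrArg (fun f => f b) h3).trans ?_
  exact (G.one_apply _).trans ((congrArg (ofBase _) hb).trans (map_zero _))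

omit hS

/-- The shear automorphism `(g, h) ↦ (g, gh)`. -/
noncomputable def shear : CSAlg.Hom (G.coord.tensor G.coord h2) (G.coord.tensor G.coord h2) :=
  G.pair h2 (G.fst h2) (G.fst h2 * G.snd h2)

/-- The inverse `(g, h) ↦ (g, g⁻¹h)` of the shear automorphism. -/
noncomputable def shearInv : CSAlg.Hom (G.coord.tensor G.coord h2) (G.coord.tensor G.coord h2) :=
  G.pair h2 (G.fst h2) ((G.fst h2)⁻¹ * G.snd h2)

lemma hom_ext_of_map {A : CSAlg k} {f g : CSAlg.Hom (G.coord.tensor G.coord h2) A}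
    (hl : G.map f (G.fst h2) = G.map g (G.fst h2))
    (hr : G.map f (G.snd h2) = G.map g (G.snd h2)) : f = g :=
  tensor_hom_ext h2 (GradedAlgHom.congr_fun hl) (GradedAlgHom.congr_fun hr)

lemma shear_shearInv (t : G.coord.tensor G.coord h2) :
    G.shear h2 (G.shearInv h2 t) = t := by
  have : (G.shear h2).comp (G.shearInv h2) = GradedAlgHom.id k _ := by
    refine G.hom_ext_of_map h2 ?_ ?_ <;> rw [← map_map, shear, shearInv]
    · rw [map_pair_fst, map_pair_fst]
      rfl
    · rw [map_pair_snd, map_mul, map_inv, map_pair_fst, map_pair_snd, inv_mul_cancel_left]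
      rfl
  exact GradedAlgHom.congr_fun this t

lemma shearInv_shear (t : G.coord.tensor G.coord h2) :
    G.shearInv h2 (G.shear h2 t) = t := by
  have : (G.shearInv h2).comp (G.shear h2) = GradedAlgHom.id k _ := by
    refine G.hom_ext_of_map h2 ?_ ?_ <;> rw [← map_map, shear, shearInv]
    · rw [map_pair_fst, map_pair_fst]
      rfl
    · rw [map_pair_snd, map_mul, map_pair_fst, map_pair_snd, mul_inv_cancel_left]
      rfl
  exact GradedAlgHom.congr_fun this t

lemma shear_inl (a : G.coord) : G.shear h2 (inl h2 _ _ a) = inl h2 _ _ a :=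
  GradedAlgHom.congr_fun (G.map_pair_fst h2 (G.fst h2) (G.fst h2 * G.snd h2)) a

lemma shear_inr (a : G.coord) : G.shear h2 (inr h2 _ _ a) =
    (show CSAlg.Hom G.coord _ from G.fst h2 * G.snd h2) a :=
  GradedAlgHom.congr_fun (G.map_pair_snd h2 (G.fst h2) (G.fst h2 * G.snd h2)) a

lemma shearInv_inr (a : G.coord) : G.shearInv h2 (inr h2 _ _ a) =
    (show CSAlg.Hom G.coord _ from (G.fst h2)⁻¹ * G.snd h2) a :=
  GradedAlgHom.congr_fun (G.map_pair_snd h2 (G.fst h2) ((G.fst h2)⁻¹ * G.snd h2)) a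

variable (S)

/-- The subspace of `k[G]` generated by the augmentation ideal of a subalgebra. -/
def augSpan : Submodule k G.coord := (Ideal.span (G.augElements S)).restrictScalars k

/-- The projection `k[G] ⊗ k[G] → k[G] ⊗_S k[G]`. -/
noncomputable def toBalanced : G.coord.tensor G.coord h2 →ₗ[k] G.coord ⊗[S] G.coord :=
  (TensorProduct.mapOfCompatibleSMul S k k G.coord G.coord) ∘ₗ
    (tensorEquiv h2 G.coord G.coord).symm.toLinearMap

/-- The projection from `k[G] ⊗ k[G]` to the tensor product of `k[G]` and the coordinate space of
the kernel. -/
noncomputable def toFiber :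
    G.coord.tensor G.coord h2 →ₗ[k] G.coord ⊗[k] (G.coord ⧸ G.augSpan S) :=
  (G.augSpan S).mkQ.lTensor G.coord ∘ₗ (tensorEquiv h2 G.coord G.coord).symm.toLinearMap

lemma toBalanced_mul (a b : G.coord) :
    G.toBalanced h2 S (inl h2 _ _ a * inr h2 _ _ b) = a ⊗ₜ[S] b := by
  rw [toBalanced, LinearMap.comp_apply, ← tensorEquiv_tmul, LinearEquiv.coe_coe,
    LinearEquiv.symm_apply_apply]
  rfl

lemma toFiber_mul (a b : G.coord) :
    G.toFiber h2 S (inl h2 _ _ a * inr h2 _ _ b) = a ⊗ₜ[k] (G.augSpan S).mkQ b := by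
  rw [toFiber, LinearMap.comp_apply, ← tensorEquiv_tmul, LinearEquiv.coe_coe,
    LinearEquiv.symm_apply_apply]
  rfl

lemma toFiber_smul (s : S) (t : G.coord.tensor G.coord h2) :
    G.toFiber h2 S (inl h2 _ _ (G.coord.evenIncl S s) * t) = s • G.toFiber h2 S t := by
  induction t using tensor_span_induction with
  | add x y hx hy => rw [mul_add, map_add, map_add, smul_add, hx, hy]
  | mul a b =>
    rw [← mul_assoc, ← map_mul, toFiber_mul, toFiber_mul]
    rfl

lemma toFiber_eq_zero {t : G.coord.tensor G.coord h2} (ht : t ∈ Ideal.span (G.sndAug h2 S)) :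
    G.toFiber h2 S t = 0 := by
  have : ∀ u, G.toFiber h2 S (u * t) = 0 := by
    induction ht using Submodule.span_induction with
    | zero => simp
    | add x y _ _ hx hy => intro u; rw [mul_add, map_add, hx, hy, add_zero]
    | smul c x _ hx => intro u; rw [smul_eq_mul, ← mul_assoc]; exact hx _
    | mem x hx =>
      obtain ⟨m, hm, rfl⟩ := hx
      intro u
      induction u using tensor_span_induction with
      | add x y hx hy => rw [add_mul, map_add, hx, hy, add_zero]
      | mul a b =>
        rw [mul_assoc, ← map_mul, toFiber_mul]
        have : (G.augSpan S).mkQ (b * m) = 0 := by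
          rw [Submodule.mkQ_apply, Submodule.Quotient.mk_eq_zero]
          exact Ideal.mul_mem_left _ _ (Ideal.subset_span hm)
        rw [this, tmul_zero]
  have h := this 1
  rwa [one_mul] at h

lemma mem_span_of_toFiber_eq_zero {t : G.coord.tensor G.coord h2} (ht : G.toFiber h2 S t = 0) :
    t ∈ Ideal.span (G.sndAug h2 S) := by
  have hex : Function.Exact (G.augSpan S).subtype (G.augSpan S).mkQ :=
    LinearMap.exact_subtype_mkQ _
  obtain ⟨w, hw⟩ := (lTensor_exact G.coord hex (Submodule.mkQ_surjective _)
    ((tensorEquiv h2 G.coord G.coord).symm t)).1 ht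
  rw [eq_comm, LinearEquiv.symm_apply_eq] at hw
  rw [hw]
  clear hw ht
  induction w using TensorProduct.induction_on with
  | zero => rw [map_zero, map_zero]; exact zero_mem _
  | add x y hx hy => rw [map_add, map_add]; exact add_mem hx hy
  | tmul a n =>
    obtain ⟨n, hn⟩ := n
    rw [LinearMap.lTensor_tmul, tensorEquiv_tmul]
    refine Ideal.mul_mem_left _ _ ?_
    change inr h2 _ _ n ∈ _
    replace hn : n ∈ Ideal.span (G.augElements S) := hn
    induction hn using Submodule.span_induction with
    | zero => rw [map_zero]; exact zero_mem _
    | add x y _ _ hx hy => rw [map_add]; exact add_mem hx hy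
    | smul c x _ hx => rw [smul_eq_mul, map_mul]; exact Ideal.mul_mem_left _ _ hx
    | mem x hx => exact Ideal.subset_span ⟨x, hx, rfl⟩

lemma toBalanced_eq_zero {t : G.coord.tensor G.coord h2} (ht : t ∈ Ideal.span (G.balanced h2 S)) :
    G.toBalanced h2 S t = 0 := by
  have : ∀ u, G.toBalanced h2 S (u * t) = 0 := by
    induction ht using Submodule.span_induction with
    | zero => simp
    | add x y _ _ hx hy => intro u; rw [mul_add, map_add, hx, hy, add_zero]
    | smul c x _ hx => intro u; rw [smul_eq_mul, ← mul_assoc]; exact hx _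
    | mem x hx =>
      obtain ⟨s, rfl⟩ := hx
      intro u
      induction u using tensor_span_induction with
      | add x y hx hy => rw [add_mul, map_add, hx, hy, add_zero]
      | mul a b =>
        have hc : Commute (inl h2 G.coord G.coord (G.coord.evenIncl S s)) (inr h2 _ _ b) :=
          commute_of_even _ (Hom.map_mem_grading _ s.1.2) _
        have ha : G.coord.evenIncl S s * a = a * G.coord.evenIncl S s :=
          commute_of_even _ s.1.2 a
        have hb : G.coord.evenIncl S s * b = b * G.coord.evenIncl S s :=
          commute_of_even _ s.1.2 b
        rw [mul_sub, mul_assoc, ← hc.eq, ← mul_assoc, ← map_mul, mul_assoc, ← map_mul, map_sub,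
          toBalanced_mul, toBalanced_mul, sub_eq_zero, ← ha, ← hb]
        exact TensorProduct.smul_tmul s a b
  have h := this 1
  rwa [one_mul] at h

lemma toBalanced_surjective : Function.Surjective (G.toBalanced h2 S) := by
  intro z
  induction z using TensorProduct.induction_on with
  | zero => exact ⟨0, map_zero _⟩
  | tmul a b => exact ⟨_, G.toBalanced_mul h2 S a b⟩
  | add x y hx hy =>
    obtain ⟨x, rfl⟩ := hx
    obtain ⟨y, rfl⟩ := hy
    exact ⟨x + y, map_add _ _ _⟩

lemma toFiber_surjective : Function.Surjective (G.toFiber h2 S) :=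
  (LinearMap.lTensor_surjective _ (Submodule.mkQ_surjective _)).comp
    (tensorEquiv h2 G.coord G.coord).symm.surjective

variable {S}

/-- The torsor map `k[G] ⊗_S k[G] → k[G] ⊗ k[ker]`. -/
noncomputable def torsorMap (hS : IsHopfSub h2 G (G.coord.evenIncl S)) :
    G.coord ⊗[S] G.coord →ₗ[S] G.coord ⊗[k] (G.coord ⧸ G.augSpan S) :=
  TensorProduct.lift (LinearMap.mk₂ S
    (fun a b => G.toFiber h2 S (G.shear h2 (inl h2 _ _ a * inr h2 _ _ b)))
    (fun a a' b => by simp only [map_add, add_mul])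
    (fun s a b => by
      rw [smul_even_def, map_mul (inl h2 _ _), mul_assoc, map_mul (G.shear h2), shear_inl,
        toFiber_smul])
    (fun a b b' => by simp only [map_add, mul_add])
    -- Linearity over `S` in the second variable holds because `gh` and `g` agree on `S` when `h`
    -- lies in the kernel.
    (fun s a b => by
      rw [smul_even_def, ← toFiber_smul, ← sub_eq_zero, ← map_sub]
      apply toFiber_eq_zero
      have hc : Commute (inl h2 G.coord G.coord (G.coord.evenIncl S s)) (inl h2 _ _ a) :=
        commute_of_even _ (Hom.map_mem_grading _ s.1.2) _
      have hc' : Commute ((show CSAlg.Hom G.coord _ from G.fst h2 * G.snd h2)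
          (G.coord.evenIncl S s) - inl h2 G.coord G.coord (G.coord.evenIncl S s))
          (G.shear h2 (inr h2 _ _ b)) :=
        commute_of_even _ (sub_mem (Hom.map_mem_grading _ s.1.2) (Hom.map_mem_grading _ s.1.2)) _
      rw [map_mul (inr h2 _ _), map_mul (G.shear h2), map_mul (G.shear h2), map_mul (G.shear h2),
        shear_inl, shear_inr h2 G (G.coord.evenIncl S s), ← mul_assoc, ← mul_assoc, hc.eq,
        ← sub_mul, ← mul_sub, mul_assoc, hc'.eq, ← mul_assoc]
      exact Ideal.mul_mem_left _ _ (G.mul_sub_inl_mem_span h2 hS s)))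

lemma torsorMap_toBalanced (hS : IsHopfSub h2 G (G.coord.evenIncl S))
    (t : G.coord.tensor G.coord h2) :
    G.torsorMap h2 hS (G.toBalanced h2 S t) = G.toFiber h2 S (G.shear h2 t) := by
  induction t using tensor_span_induction with
  | add x y hx hy => rw [map_add, map_add, hx, hy, map_add, map_add]
  | mul a b => rw [toBalanced_mul]; rfl

/-- Pairs `(g, h)` with the same image in `Spec S` correspond to pairs `(g, g⁻¹h)` with second entry
in the kernel. Injectivity amounts to the inverse shear carrying the ideal of `sndAug` into that of
`balanced`. -/
lemma torsorMap_bijective (hS : IsHopfSub h2 G (G.coord.evenIncl S)) :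
    Function.Bijective (G.torsorMap h2 hS) := by
  constructor
  · rw [injective_iff_map_eq_zero]
    intro z hz
    obtain ⟨t, rfl⟩ := G.toBalanced_surjective h2 S z
    rw [torsorMap_toBalanced] at hz
    have ht := G.mem_span_of_toFiber_eq_zero h2 S hz
    apply toBalanced_eq_zero
    rw [← G.shearInv_shear h2 t]
    generalize G.shear h2 t = w at ht
    induction ht using Submodule.span_induction with
    | zero => rw [map_zero]; exact zero_mem _
    | add x y _ _ hx hy => rw [map_add]; exact add_mem hx hy
    | smul c x _ hx => rw [smul_eq_mul, map_mul]; exact Ideal.mul_mem_left _ _ hx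
    | mem x hx =>
      obtain ⟨_, ⟨b, hb, rfl⟩, rfl⟩ := hx
      rw [shearInv_inr]
      exact G.inv_mul_mem_span h2 hS hb
  · intro z
    obtain ⟨t, rfl⟩ := G.toFiber_surjective h2 S z
    exact ⟨G.toBalanced h2 S (G.shearInv h2 t), by rw [torsorMap_toBalanced, shear_shearInv]⟩

/-- `S` acts on the quotient through the counit, so generators over `S` become generators over `k`.
-/
lemma finite_fiber [Module.Finite S G.coord] : Module.Finite k (G.coord ⧸ G.augSpan S) := by
  classical
  obtain ⟨n, r, hr⟩ := Module.Finite.exists_fin (R := S) (M := G.coord)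
  refine ⟨⟨Finset.univ.image fun i => (G.augSpan S).mkQ (r i), ?_⟩⟩
  rw [eq_top_iff]
  rintro z -
  obtain ⟨x, rfl⟩ := Submodule.mkQ_surjective _ z
  have hx : x ∈ Submodule.span S (Set.range r) := hr ▸ trivial
  induction hx using Submodule.span_induction with
  | zero => rw [map_zero]; exact zero_mem _
  | add x y _ _ hx hy => rw [map_add]; exact add_mem hx hy
  | mem x hx =>
    obtain ⟨i, rfl⟩ := hx
    exact Submodule.subset_span (by simp)
  | smul s x _ hx =>
    have : (G.augSpan S).mkQ (s • x) =
        (G.counit (G.coord.evenIncl S s) : k) • (G.augSpan S).mkQ x := by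
      rw [← map_smul, ← sub_eq_zero, ← map_sub, Submodule.mkQ_apply,
        Submodule.Quotient.mk_eq_zero, smul_even_def]
      have hm := G.sub_algebraMap_mem_augElements s
      obtain ⟨b, hb, hbe⟩ := hm
      have h1 : G.coord.evenIncl S s * x - (G.counit (G.coord.evenIncl S s) : k) • x =
          x * G.coord.evenIncl S b := by
        have hx : G.coord.evenIncl S b * x = x * G.coord.evenIncl S b :=
          commute_of_even _ b.1.2 x
        rw [← hx, hbe, sub_mul, Algebra.smul_def]
      rw [h1]
      exact Ideal.mul_mem_left _ _ (Ideal.subset_span ⟨b, hb, rfl⟩)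
    rw [this]
    exact Submodule.smul_mem _ _ hx

include h2 in
/-- `k[G]` is projective over every sub-Hopf-algebra over which it is finite. -/
lemma projective_of_finite (hS : IsHopfSub h2 G (G.coord.evenIncl S)) [IsNoetherianRing S]
    [Module.Finite S G.coord] : Module.Projective S G.coord := by
  have := G.finite_fiber (S := S)
  have he : ∀ b : S, b • (1 : G.coord) = 0 → b = 0 := fun b hb =>
    evenIncl_injective _ _ ((mul_one _).symm.trans (hb.trans (map_zero (G.coord.evenIncl S)).symm))
  exact Module.Projective.of_tensor_self_equiv_pi he
    (LinearEquiv.ofBijective _ (G.torsorMap_bijective h2 hS) ≪≫ₗ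
      TensorProduct.AlgebraTensorModule.congr (LinearEquiv.refl S G.coord)
        (Module.finBasis k (G.coord ⧸ G.augSpan S)).equivFun ≪≫ₗ
      TensorProduct.piScalarRight k S G.coord (Fin _))

end Torsor

end AffineSupergroup

namespace CSAlg

variable {k : Type u} [Field k]

/-! ### Criteria for faithful flatness over a purely even algebra. -/

section FaithfullyFlat

variable {S : Type u} [CommRing S] [Algebra k S] {A : CSAlg k} (φ : Hom (ofComm k S) A)
  [Module S A] (hφ : ∀ (s : S) (a : A), s • a = φ s * a)

include hφ

/-- The image of `φ` is central, so left and right actions of `S` agree and the left ideal generated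
by `φ(I)` is `I • ⊤`; the usual commutative criteria then apply. -/
lemma isFaithfullyFlat_of_module [Module.Flat S A]
    (hS : ∀ I : Ideal S, I • (⊤ : Submodule S A) = ⊤ → I = ⊤) : IsFaithfullyFlat φ where
  flat n a b h := by
    have hc : ∀ (s : S) (x : A), x * φ s = s • x := fun s x => by
      rw [hφ]
      exact ((A.commute_of_even (ofComm_hom_even φ s) x).eq).symm
    have h' : ∑ i, (show S from a i) • b i = 0 := by
      rw [← h]
      exact Finset.sum_congr rfl fun i _ => (hc _ _).symm
    obtain ⟨m, c, y, hy, hc0⟩ :=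
      (Module.Flat.iff_forall_isTrivialRelation.1 ‹_› h' : Module.IsTrivialRelation _ _)
    refine ⟨m, fun j i => c i j, y, fun i => ?_, fun j => ?_⟩
    · rw [hy]
      exact Finset.sum_congr rfl fun j _ => (hc _ _).symm
    · rw [← hc0 j]
      exact Finset.sum_congr rfl fun i _ => mul_comm (G := S) _ _
  faithful I hI := by
    refine hS I (eq_top_iff.2 ?_)
    rintro x -
    have hx : x ∈ Ideal.map φ I := hI ▸ Submodule.mem_top
    rw [Ideal.map] at hx
    induction hx using Submodule.span_induction with
    | zero => exact zero_mem _
    | add x y _ _ hx hy => exact add_mem hx hy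
    | mem x hx =>
      obtain ⟨s, hs, rfl⟩ := hx
      have : (s : S) • (1 : A) ∈ I • (⊤ : Submodule S A) :=
        Submodule.smul_mem_smul hs Submodule.mem_top
      rwa [hφ, mul_one] at this
    | smul c x _ hx =>
      refine Submodule.smul_induction_on hx (fun s hs y _ => ?_) fun y z hy hz => ?_
      · have : c • s • y = s • (c * y) := by
          rw [hφ, hφ, smul_eq_mul, ← mul_assoc, ← mul_assoc,
            (A.commute_of_even (ofComm_hom_even φ s) c).eq]
        rw [this]
        exact Submodule.smul_mem_smul hs Submodule.mem_top
      · rw [smul_add]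
        exact add_mem hy hz

lemma smul_one_eq_zero (hinj : Function.Injective φ) {s : S} (hs : s • (1 : A) = 0) : s = 0 := by
  rw [hφ, mul_one] at hs
  exact hinj (hs.trans (map_zero φ).symm)

/-- An injective morphism making its target a finite projective module is faithfully flat. -/
lemma isFaithfullyFlat_of_finite [Module.Flat S A] [Module.Finite S A]
    (hinj : Function.Injective φ) : IsFaithfullyFlat φ := by
  refine isFaithfullyFlat_of_module φ hφ fun I hI => ?_
  obtain ⟨s, hs, h⟩ := Submodule.exists_sub_one_mem_and_smul_eq_zero_of_fg_of_le_smul I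
    (⊤ : Submodule S A) Module.Finite.fg_top hI.ge
  rw [smul_one_eq_zero φ hφ hinj (h 1 trivial), zero_sub, neg_mem_iff] at hs
  exact I.eq_top_iff_one.2 hs

omit [Module S A] hφ in
/-- Every injective morphism from a finite reduced commutative algebra is faithfully flat. -/
lemma isFaithfullyFlat_of_isReduced [Module.Finite k S] [IsReduced S]
    (hinj : Function.Injective φ) : IsFaithfullyFlat φ := by
  have : IsArtinianRing S := IsArtinianRing.of_finite k S
  have : IsSemisimpleRing S := IsArtinianRing.isSemisimpleRing_of_isReduced S
  let _ : Module S A := Module.compHom A (show S →+* A from φ)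
  have hφ : ∀ (s : S) (a : A), s • a = φ s * a := fun _ _ => rfl
  have : Module.Projective S A := Module.projective_of_isSemisimpleRing S A
  refine isFaithfullyFlat_of_module φ hφ fun I hI => ?_
  -- By semisimplicity `I` has a complement `J`. As `J * I = 0` and `I • ⊤ = ⊤`, `J` kills `1 ∈ A`,
  -- and injectivity gives `J = 0`.
  obtain ⟨J, hJ⟩ := exists_isCompl I
  have hJ0 : J = ⊥ := by
    refine eq_bot_iff.2 fun e he => ?_
    have h : ∀ x ∈ I • (⊤ : Submodule S A), e • x = 0 := by
      intro x hx
      refine Submodule.smul_induction_on hx (fun s hs y _ => ?_) fun y z hy hz => ?_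
      · have h0 : e * s ∈ I ⊓ J := ⟨I.mul_mem_left _ hs, J.mul_mem_right _ he⟩
        rw [hJ.inf_eq_bot, Submodule.mem_bot] at h0
        rw [smul_smul, h0, zero_smul]
      · rw [smul_add, hy, hz, add_zero]
    exact smul_one_eq_zero φ hφ hinj (h 1 (hI.ge trivial))
  rw [← hJ.sup_eq_top, hJ0, sup_bot_eq]

end FaithfullyFlat

end CSAlg

/-! ### Étale superalgebras, retractions onto reduced subalgebras, and nil ideals. -/

namespace CSAlg

variable {k : Type u} [Field k]

variable {p : ℕ} [Fact p.Prime] [CharP k p] [PerfectField k]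

/-- In an étale superalgebra, every element is a `p ^ n`-th power. -/
lemma IsEtale.exists_pow_eq {A : CSAlg k} [Nontrivial A] (hA : A.IsEtale) (n : ℕ) (a : A) :
    ∃ b : A, b ^ p ^ n = a := by
  obtain ⟨h, hA⟩ := hA
  let _ := A.commRing h
  have : Module.Finite k A := Algebra.FormallyUnramified.finite_of_free k A
  have : IsReduced A := Algebra.FormallyUnramified.isReduced_of_field k A
  have : CharP A p := charP_of_injective_algebraMap (algebraMap k A).injective p
  induction n with
  | zero => exact ⟨a, by simp⟩
  | succ n ih =>
    obtain ⟨b, rfl⟩ := ih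
    obtain ⟨c, rfl⟩ := exists_pow_eq_of_finite_reduced k (p := p) b
    exact ⟨c, by rw [pow_succ', pow_mul]⟩

omit [PerfectField k] in
lemma isPurelyEven_ofComm (S : Type u) [CommRing S] [Algebra k S] : (ofComm k S).IsPurelyEven :=
  eq_top_iff.2 fun s _ => mem_ofComm_zero s

lemma isEtale_ofComm (S : Type u) [CommRing S] [Algebra k S] [Module.Finite k S] [IsReduced S] :
    (ofComm k S).IsEtale :=
  ⟨isPurelyEven_ofComm S, Algebra.Etale.of_finite_of_isReduced k S⟩

omit [PerfectField k] in
/-- Points with values in a reduced commutative algebra are determined by their values on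
`p ^ n`-th powers. -/
lemma Hom.ext_of_pow {A : CSAlg k} {R : Type u} [CommRing R] [Algebra k R]
    [IsReduced R] {f g : Hom A (ofComm k R)} (n : ℕ)
    (h : ∀ a : A, f (a ^ p ^ n) = g (a ^ p ^ n)) : f = g := by
  ext a
  have h1 := h a
  rw [map_pow, map_pow] at h1
  rcases subsingleton_or_nontrivial R with hR | hR
  · exact Subsingleton.elim (α := R) _ _
  have : CharP R p := charP_of_injective_algebraMap (algebraMap k R).injective p
  exact iterateFrobenius_inj R p n h1

/-- A retraction of a finite superalgebra onto a reduced subalgebra containing all `p ^ n`-th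
powers. -/
lemma exists_retraction (hp : 2 < p) (A : CSAlg k) (S : Subalgebra k A.even) [Nontrivial S]
    [Module.Finite k S] [IsReduced S] {n : ℕ} (hn : n ≠ 0)
    (hpow : ∀ a : A, a ^ p ^ n ∈ A.evenRange S) :
    ∃ r : Hom A (ofComm k S), ∀ s : S, r (A.evenIncl S s) = s := by
  have hch : CharP S p := charP_of_injective_algebraMap (algebraMap k S).injective p
  have hex : ∀ a : A, ∃ s : S, A.evenIncl S s ^ p ^ n = a ^ p ^ n := by
    intro a
    obtain ⟨s, hs⟩ := hpow a
    obtain ⟨t, rfl⟩ := (isEtale_ofComm S).exists_pow_eq (p := p) n s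
    exact ⟨t, (map_pow (A.evenIncl S) t _).symm.trans hs⟩
  have hinj : ∀ s t : S, A.evenIncl S s ^ p ^ n = A.evenIncl S t ^ p ^ n → s = t := by
    intro s t h
    rw [← map_pow, ← map_pow] at h
    exact iterateFrobenius_inj S p n (evenIncl_injective A S h)
  -- `r a` is the unique `p ^ n`-th root in `S` of `a ^ p ^ n`: it exists because the finite reduced
  -- algebra `S` is perfect. Uniqueness makes `r` a homomorphism.
  choose r hr using hex
  have hr' : ∀ s : S, r (A.evenIncl S s) = s := fun s => hinj _ _ (hr _)
  let f : A →ₐ[k] S :=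
    { toFun := r
      map_one' := hinj _ _ (by rw [hr]; exact congrArg (· ^ p ^ n) (map_one (A.evenIncl S)).symm)
      map_mul' := fun a b => hinj _ _ (by
        rw [hr, A.mul_pow_frob hp, ← hr a, ← hr b, ← A.mul_pow_frob hp]
        exact congrArg (· ^ p ^ n) (map_mul (A.evenIncl S) _ _).symm)
      map_zero' := hinj _ _ (by rw [hr]; exact congrArg (· ^ p ^ n) (map_zero (A.evenIncl S)).symm)
      map_add' := fun a b => hinj _ _ (by
        rw [hr, A.add_pow_frob hp, ← hr a, ← hr b, ← A.add_pow_frob hp]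
        exact congrArg (· ^ p ^ n) (map_add (A.evenIncl S) _ _).symm)
      commutes' := fun c => hr' (algebraMap k S c) }
  refine ⟨⟨f, ?_⟩, hr'⟩
  intro i a ha
  rcases zmod_two_cases i with rfl | rfl
  · exact mem_ofComm_zero _
  -- Here `n ≠ 0` matters: the exponent has to be at least two.
  · have h0 : a ^ p ^ n = 0 := pow_eq_zero_of_le (m := 2)
      (hp.le.trans (Nat.le_self_pow hn p)) (by rw [sq, A.mul_self_of_odd hp ha])
    have : r a = 0 := hinj _ _ (by
      rw [hr, h0, show A.evenIncl S 0 = 0 from map_zero (A.evenIncl S), zero_pow]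
      exact (pow_pos (by omega) _).ne')
    change r a ∈ _
    rw [this]
    exact zero_mem _

omit [PerfectField k] in
/-- In a finite superalgebra, a left ideal of nilpotent elements is nilpotent. -/
lemma exists_pow_eq_bot (A : CSAlg k) [Module.Finite k A] {I : Ideal A}
    (hI : ∀ a ∈ I, IsNilpotent a) : ∃ n, I ^ n = ⊥ := by
  -- A nil left ideal lies in the Jacobson radical, which is nilpotent in an Artinian ring.
  have : IsArtinianRing A := IsArtinianRing.of_finite k A
  obtain ⟨n, hn⟩ := IsArtinianRing.isNilpotent_jacobson_bot (R := A)
  refine ⟨n, le_bot_iff.1 (le_trans (Ideal.pow_right_mono ?_ n) hn.le)⟩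
  intro x hx
  refine Ideal.mem_jacobson_iff.2 fun y => ?_
  obtain ⟨z, hz⟩ := (hI _ (I.mul_mem_left y hx)).isUnit_one_add.exists_left_inv
  refine ⟨z, ?_⟩
  rw [Ideal.mem_bot, sub_eq_zero, ← hz, mul_assoc]
  noncomm_ring

end CSAlg

/-! ### The quotient by the Frobenius kernel, and sections. -/

namespace AffineSupergroup

open CSAlg

variable {k : Type u} [Field k] {p : ℕ} [Fact p.Prime] [CharP k p] [PerfectField k]

/-- A point lies in `G₁` exactly when it agrees with the identity on all `p`-th powers, and these
are the elements of the subalgebra. -/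
lemma ker_hom_powers (h2 : (2 : k) ≠ 0) (hp : 2 < p) (G : AffineSupergroup k) (A : CSAlg k) :
    ((G.isHopfSub_powers h2 hp 0).hom.app A).ker = G.frobeniusKernel hp A := by
  have hfrob : ∀ g : G.Points A, g ∈ G.frobeniusKernel hp A ↔
      ∀ a : G.coord, (show CSAlg.Hom G.coord A from g) a ^ p =
        (show CSAlg.Hom G.coord A from (1 : G.Points A)) a ^ p := by
    intro g
    rw [frobeniusKernel, MonoidHom.mem_ker, ← map_one (G.map (A.frob hp))]
    constructor
    · intro h a
      exact GradedAlgHom.congr_fun h a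
    · intro h
      exact points_ext h
  ext g
  rw [hfrob, MonoidHom.mem_ker, ← map_one ((G.isHopfSub_powers h2 hp 0).hom.app A)]
  constructor
  · intro h a
    obtain ⟨s, hs⟩ := G.coord.pow_mem_evenRange_powers hp 0 a
    have hs : G.coord.evenIncl _ s = a ^ p ^ 1 := hs
    rw [pow_one] at hs
    rw [← map_pow, ← map_pow, ← hs]
    exact GradedAlgHom.congr_fun h s
  · intro h
    refine points_ext fun s => ?_
    obtain ⟨x, hx⟩ := G.coord.exists_pow_of_mem_powers s
    have hx : (x : G.coord) ^ p = G.coord.evenIncl _ s :=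
      (congrArg ((x : G.coord) ^ ·) (pow_one p)).symm.trans hx
    change (show CSAlg.Hom G.coord A from g) (G.coord.evenIncl _ s) =
      (show CSAlg.Hom G.coord A from (1 : G.Points A)) (G.coord.evenIncl _ s)
    rw [← hx, map_pow, map_pow, h]

lemma faithfullyFlat_hom_powers (h2 : (2 : k) ≠ 0) (hp : 2 < p) (G : AffineSupergroup k)
    (hG : G.IsAlgebraic) (n : ℕ) :
    IsFaithfullyFlat (G.coord.evenIncl (Subalgebra.powers k p G.coord.even (n + 1))) := by
  have := finite_powers hp hG n
  have := finiteType_powers hp hG n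
  have : IsNoetherianRing (Subalgebra.powers k p G.coord.even (n + 1)) :=
    Algebra.FiniteType.isNoetherianRing k _
  have := G.projective_of_finite h2 (G.isHopfSub_powers h2 hp n)
  exact isFaithfullyFlat_of_finite _ (fun _ _ => rfl) (evenIncl_injective _ _)

omit [PerfectField k] in
/-- The section of `G → Spec S` given by the retraction. -/
lemma IsHopfSub.exists_section {h2 : (2 : k) ≠ 0} {G : AffineSupergroup k}
    {S : Subalgebra k G.coord.even} (hS : IsHopfSub h2 G (G.coord.evenIncl S))
    [IsReduced (S ⊗[k] S)] {r : CSAlg.Hom G.coord (ofComm k S)}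
    (hr : ∀ s : S, r (G.coord.evenIncl S s) = s) {n : ℕ}
    (hpow : ∀ a : G.coord, a ^ p ^ n ∈ G.coord.evenRange S) :
    ∃ s : Hom hS.spec G, ∀ (A : CSAlg k) (x : hS.spec.Points A), hS.hom.app A (s.app A x) = x := by
  have hr' : ∀ {A : CSAlg k} (x : hS.spec.Points A),
      hS.hom.app A (pullback (G' := G) r x) = x := fun {A} x => by
    refine points_ext fun s => ?_
    exact congrArg (show CSAlg.Hom (ofComm k S) A from x) (hr s)
  refine ⟨⟨r, ?_⟩, fun A x => hr' x⟩
  intro A x y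
  let x₀ : hS.spec.Points (ofComm k (S ⊗[k] S)) := ofCommInl k S S
  let y₀ : hS.spec.Points (ofComm k (S ⊗[k] S)) := ofCommInr k S S
  let w : CSAlg.Hom (ofComm k (S ⊗[k] S)) A :=
    ofCommPair (show CSAlg.Hom (ofComm k S) A from x) (show CSAlg.Hom (ofComm k S) A from y)
  have hx : hS.spec.map w x₀ = x := ofCommPair_comp_inl _ _
  have hy : hS.spec.map w y₀ = y := ofCommPair_comp_inr _ _
  have nat : ∀ {A B : CSAlg k} (ψ : CSAlg.Hom A B) (z : hS.spec.Points A),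
    pullback (G' := G) r (hS.spec.map ψ z) = G.map ψ (pullback (G' := G) r z) := fun _ _ => rfl
  rw [← hx, ← hy, ← map_mul, nat, nat, nat, ← map_mul]
  congr 1
  -- The two points of `G` agree on `S`, hence on all `p ^ n`-th powers; having values in the
  -- reduced algebra `S ⊗ S`, they are equal.
  have key : hS.hom.app _ (pullback (G' := G) r (x₀ * y₀)) =
      hS.hom.app _ (pullback (G' := G) r x₀ * pullback (G' := G) r y₀) := by
    rw [map_mul, hr', hr', hr']
  refine Hom.ext_of_pow (p := p) n fun a => ?_
  obtain ⟨s, hs⟩ := hpow a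
  rw [← hs]
  exact GradedAlgHom.congr_fun key s

end AffineSupergroup

namespace AffineSupergroup

open CSAlg

variable {k : Type u} [Field k] {p : ℕ} [Fact p.Prime] [CharP k p] [PerfectField k]

/-! ### The component group, its section for finite `G`, and infinitesimality of the kernel. -/

section PerfectCore

variable (h2 : (2 : k) ≠ 0) (hp : 2 < p) (G : AffineSupergroup k)

lemma finite_perfectCore_even (hp : 2 < p) (hG : G.IsAlgebraic) :
    Module.Finite k (Subalgebra.perfectCore k p G.coord.even) := by
  have := finiteType_even hp hG
  exact Subalgebra.finite_perfectCore

lemma isReduced_perfectCore_even (hp : 2 < p) (hG : G.IsAlgebraic) :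
    IsReduced (Subalgebra.perfectCore k p G.coord.even) := by
  have := finiteType_even hp hG
  have : IsNoetherianRing G.coord.even := Algebra.FiniteType.isNoetherianRing k _
  exact Subalgebra.isReduced_perfectCore

/-- The homomorphism from the quotient of `G` by its Frobenius kernel to the group scheme of the
perfect core. -/
noncomputable def toPerfectCore :
    Hom (G.isHopfSub_powers h2 hp 0).spec (G.isHopfSub_perfectCore h2 hp).spec :=
  (G.isHopfSub_powers h2 hp 0).factor (G.isHopfSub_perfectCore h2 hp).hom
    (ofCommMap (Subalgebra.inclusion
      (iInf_le _ (0 + 1) : Subalgebra.perfectCore k p G.coord.even ≤ _))) rfl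

lemma toPerfectCore_injective : Function.Injective (G.toPerfectCore h2 hp).comorph :=
  Subalgebra.inclusion_injective _

lemma toPerfectCore_comp :
    (G.toPerfectCore h2 hp).comp (G.isHopfSub_powers h2 hp 0).hom =
      (G.isHopfSub_perfectCore h2 hp).hom := rfl

variable {G}

/-- Elements of an étale algebra are `p ^ n`-th powers for every `n`, so any comorphism from one
lands in the perfect core; injectivity of its inclusion gives uniqueness. -/
lemma isComponentGroup_toPerfectCore (hG : G.IsAlgebraic) :
    (G.toPerfectCore h2 hp).IsComponentGroup := by
  have := finite_perfectCore_even G hp hG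
  have := isReduced_perfectCore_even G hp hG
  refine ⟨isEtale_ofComm _,
    isFaithfullyFlat_of_isReduced _ (G.toPerfectCore_injective h2 hp), ?_⟩
  intro E hE f
  have hmem : ∀ e : E.coord, ∃ d, (G.toPerfectCore h2 hp).comorph d = f.comorph e := by
    intro e
    let b : Subalgebra.powers k p G.coord.even (0 + 1) := f.comorph e
    have hb : b.1 ∈ Subalgebra.perfectCore k p G.coord.even := by
      refine Subalgebra.mem_perfectCore.2 fun n => ?_
      obtain ⟨e', rfl⟩ := hE.exists_pow_eq (p := p) n e
      let b' : Subalgebra.powers k p G.coord.even (0 + 1) := f.comorph e'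
      exact ⟨b'.1, congrArg Subtype.val (map_pow f.comorph e' _).symm⟩
    exact ⟨⟨b.1, hb⟩, rfl⟩
  obtain ⟨φ, hφ⟩ := exists_comp_eq h2 (G.toPerfectCore_injective h2 hp) hmem
  refine ⟨(G.isHopfSub_perfectCore h2 hp).factor (f.comp (G.isHopfSub_powers h2 hp 0).hom) φ
    (congrArg (GradedAlgHom.comp (G.isHopfSub_powers h2 hp 0).hom.comorph) hφ),
    Hom.ext_comorph hφ, ?_⟩
  intro f' hf'
  refine Hom.ext_comorph (CSAlg.Hom.cancel_inj (G.toPerfectCore_injective h2 hp) ?_)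
  exact (congrArg Hom.comorph hf').trans hφ.symm

include hp in
lemma exists_pow_mem_perfectCore (hG : G.IsFinite) : ∃ n : ℕ, n ≠ 0 ∧
    ∀ a : G.coord, a ^ p ^ n ∈ G.coord.evenRange (Subalgebra.perfectCore k p G.coord.even) := by
  have : Module.Finite k G.coord := hG
  have : Module.Finite k G.coord.even :=
    Module.Finite.of_injective G.coord.even.val.toLinearMap Subtype.val_injective
  obtain ⟨n, hn⟩ := Subalgebra.exists_powers_eq_perfectCore (k := k) (p := p) (C := G.coord.even)
  refine ⟨n + 1, n.succ_ne_zero, fun a => ?_⟩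
  rw [← hn _ n.le_succ]
  exact G.coord.pow_mem_evenRange_powers hp n a

lemma exists_section_perfectCore (hG : G.IsFinite) :
    ∃ s : Hom (G.isHopfSub_perfectCore h2 hp).spec G,
      ∀ (A : CSAlg k) (x : (G.isHopfSub_perfectCore h2 hp).spec.Points A),
        (G.isHopfSub_perfectCore h2 hp).hom.app A (s.app A x) = x := by
  have : Module.Finite k G.coord := hG
  have hA : G.IsAlgebraic := (inferInstance : Algebra.FiniteType k G.coord)
  have := finite_perfectCore_even G hp hA
  have := isReduced_perfectCore_even G hp hA
  let D := Subalgebra.perfectCore k p G.coord.even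
  have := Algebra.Etale.of_finite_of_isReduced k D
  -- `D ⊗ D` is étale over `D`, hence over `k`, which gives the reducedness needed for the section.
  have := Algebra.Etale.comp k D (D ⊗[k] D)
  have : IsReduced (D ⊗[k] D) := Algebra.FormallyUnramified.isReduced_of_field k (D ⊗[k] D)
  obtain ⟨n, hn, hpow⟩ := exists_pow_mem_perfectCore hp hG
  obtain ⟨r, hr⟩ := exists_retraction hp G.coord D hn hpow
  exact (G.isHopfSub_perfectCore h2 hp).exists_section hr hpow

omit [PerfectField k] in
lemma counit_comorph {N : AffineSupergroup k} (f : Hom N G) (a : G.coord) :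
    N.counit (f.comorph a) = G.counit a :=
  GradedAlgHom.congr_fun (map_one (f.app (ofComm k k))) a

/-- If `a` has counit zero, then `a ^ p ^ n` lies in the augmentation ideal of the perfect core,
which generates the ideal of the kernel. The augmentation ideal of the kernel is thus nil, and
nilpotent by finiteness. -/
lemma isInfinitesimal_kernel_perfectCore (hG : G.IsFinite)
    (hQ : (G.isHopfSub_perfectCore h2 hp).spec.IsPurelyEven) :
    (kernel h2 (G.isHopfSub_perfectCore h2 hp).hom hQ).IsInfinitesimal := by
  let f := (G.isHopfSub_perfectCore h2 hp).hom
  let mk : CSAlg.Hom G.coord (kernel h2 f hQ).coord := (kernelInclusion h2 f hQ).comorph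
  have hmk : Function.Surjective mk := kernelInclusion_isClosedEmbedding h2 f hQ
  have : Module.Finite k G.coord := hG
  have hfin : Module.Finite k (kernel h2 f hQ).coord :=
    Module.Finite.of_surjective mk.toAlgHom.toLinearMap hmk
  refine ⟨hfin, exists_pow_eq_bot _ fun a ha => ?_⟩
  obtain ⟨a, rfl⟩ := hmk a
  have ha : G.counit a = 0 := (counit_comorph (kernelInclusion h2 f hQ) a).symm.trans ha
  obtain ⟨n, -, hpow⟩ := exists_pow_mem_perfectCore hp hG
  obtain ⟨d, hd⟩ := hpow a
  refine ⟨p ^ n, ?_⟩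
  rw [← map_pow, ← hd]
  refine (quotMk_eq_zero_iff h2 _ _ (kerGenerators_even f hQ)).2
    (Ideal.subset_span ⟨d, ?_, rfl⟩)
  change f.comorph d = _ at hd
  refine (counit_comorph f d).symm.trans ?_
  rw [hd, map_pow, ha, zero_pow]
  exact (pow_pos (by omega) _).ne'

end PerfectCore

end AffineSupergroup

theorem lemma4p8 {k : Type u} [Field k] [PerfectField k] {p : ℕ} [Fact p.Prime] [CharP k p]
    (hp : 2 < p) (G : AffineSupergroup k) (hG : G.IsAlgebraic) :
    ∃ (H : AffineSupergroup k) (q : AffineSupergroup.Hom G H),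
      q.IsQuotient (G.frobeniusKernel hp) ∧ H.IsPurelyEven ∧ H.IsAlgebraic ∧
      ∃ (P : AffineSupergroup k) (ρ : AffineSupergroup.Hom H P), ρ.IsComponentGroup ∧
        ∃ (G₀ : AffineSupergroup k) (ι : AffineSupergroup.Hom G₀ G),
          ι.IsClosedEmbedding ∧ ι.IsNormal ∧
          (ρ.comp q).IsQuotient (fun A => (ι.app A).range) ∧
          (G.IsFinite →
            AffineSupergroup.IsSemidirectProduct ι (ρ.comp q) ∧ G₀.IsInfinitesimal) := by
  open AffineSupergroup CSAlg in
  have h2 := two_ne_zero_of_charP k hp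
  have hD := G.isHopfSub_perfectCore h2 hp
  have hQ : hD.spec.IsPurelyEven := isPurelyEven_ofComm _
  have := finite_perfectCore_even G hp hG
  have := isReduced_perfectCore_even G hp hG
  refine ⟨(G.isHopfSub_powers h2 hp 0).spec, (G.isHopfSub_powers h2 hp 0).hom,
    ⟨ker_hom_powers h2 hp G, faithfullyFlat_hom_powers h2 hp G hG 0⟩, isPurelyEven_ofComm _,
    finiteType_powers hp hG 0, hD.spec, G.toPerfectCore h2 hp,
    isComponentGroup_toPerfectCore h2 hp hG, kernel h2 hD.hom hQ, kernelInclusion h2 hD.hom hQ,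
    kernelInclusion_isClosedEmbedding _ _ _, kernelInclusion_isNormal _ _ _, ?_⟩
  rw [G.toPerfectCore_comp h2 hp]
  refine ⟨⟨fun A => (range_kernelInclusion h2 hD.hom hQ A).symm,
    isFaithfullyFlat_of_isReduced _ hD.injective⟩, fun hfin => ⟨?_,
      isInfinitesimal_kernel_perfectCore h2 hp hfin hQ⟩⟩
  obtain ⟨s, hs⟩ := exists_section_perfectCore h2 hp hfin
  exact isSemidirectProduct_of_section _ _ (kernelInclusion_injective h2 hD.hom hQ)
    (range_kernelInclusion h2 hD.hom hQ) s hs
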